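/- **Theorem.** Let $\varepsilon,\eta,c,\ell$ be real numbers with $$\varepsilon\in(-1,0),\quad \eta>0,\quad c\le 0<c+\ell,\quad \max(-\varepsilon,1+\varepsilon)<\ell<1 .$$ Suppose that $\varepsilon$ is a quadratic irrational number whose algebraic conjugate satisfies $\varepsilon'>0$, and that $c,\ell\in\mathbb Q(\varepsilon)$. Put $\Omega=[c,c+\ell)$, $\mathbb Z[\varepsilon]=\mathbb Z+\mathbb Z\varepsilon$ and $$\Omega_A=[c,\,c+\ell-1-\varepsilon),\qquad \Omega_B=[c+\ell-1-\varepsilon,\,c-\varepsilon),\qquad \Omega_C=[c-\varepsilon,\,c+\ell).$$ Let $u_{\varepsilon,\eta}[c,c+\ell)=(u_n)_{n\in\mathbb Z}$ be the pointed bidirectional word over $\mathcal A=\{A,B,C\}$ that codes the cut-and-project set $\Sigma=\{a+b\eta \mid a,b\in\mathbb Z,\ a+b\varepsilon\in\Omega\}$: if $\Sigma=\{x_n\mid n\in\mathbb Z\}$ with $x_n<x_{n+1}$ and $x_0=0$, the distances $x_{n+1}-x_n$ take exactly the values $1+\eta$, $1+2\eta$, $\eta$, and $u_n=A,B,C$ accordingly.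 Let $f:\Omega\to\Omega$ be the map $$f(y)=y+1+\varepsilon\ (y\in\Omega_A),\qquad f(y)=y+1+2\varepsilon\ (y\in\Omega_B),\qquad f(y)=y+\varepsilon\ (y\in\Omega_C),$$ which is a bijection. Consider the following algorithm. 1. Choose a quadratic unit $\gamma\in(0,1)$ with $\gamma\mathbb Z[\varepsilon]=\mathbb Z[\varepsilon]$ and conjugate $\gamma'>1$. 2. For $x\in\Omega$ let $\operatorname{ind}(x)=\min\{i\ge 0\mid f^{-i}(x)\in\gamma\Omega\}$ and $g_\gamma(x)=\gamma^{-1}f^{-\operatorname{ind}(x)}(x)$. Let $S=\{c_0<c_1<\dots<c_k\}$ be the smallest subset of $\Omega$ that contains $c$, $c+\ell-1-\varepsilon$, $c-\varepsilon$ and satisfies $g_\gamma(S)\subseteq S$; put $c_{k+1}=c+\ell$. 3. Let $\mathcal B=\{0,\dots,k\}$. For $i\in\mathcal B$ let $j_i=\min\{j\ge1\mid f^j(\gamma c_i)\in\gamma\Omega\}$ and let $\varphi(i)=w_0\cdots w_{j_i-1}$, where $w_j=m$ if $f^j(\gamma c_i)\in[c_m,c_{m+1})$. This determines a morphism $\varphi$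 on $\mathcal B^*$. 4. Let $v_0=m$ if $0\in[c_m,c_{m+1})$, and $v_{-1}=m$ if $f^{-1}(0)\in[c_m,c_{m+1})$. 5. Let $\psi:\mathcal B\to\mathcal A$ send $i$ to $A,B,C$ according to whether $c_i$ lies in $\Omega_A$, $\Omega_B$ or $\Omega_C$. Then a number $\gamma$ as in step 1 exists. For every such $\gamma$ the minima in steps 2 and 3 exist, the set $S$ is finite, and the resulting $\mathcal B$, $\varphi$, $v_{-1}$, $v_0$, $\psi$ satisfy $$u_{\varepsilon,\eta}[c,c+\ell)=\psi(v),\qquad v=\lim_{n\to\infty}\varphi^n(v_{-1})\,|\,\varphi^n(v_0).$$ The limit means: $v=\cdots v_{-2}v_{-1}|v_0v_1\cdots$ is a pointed bidirectional word over $\mathcal B$ with the given letters $v_{-1}|v_0$ such that $|\varphi(v_{-1})|>1$, $|\varphi(v_0)|>1$, $\varphi(v)=v$, and for every $N$ and all sufficiently large $n$ the word $v_{-N}\cdots v_{-1}$ is a suffix of $\varphi^n(v_{-1})$ and $v_0\cdots v_{N-1}$ is a prefix of $\varphi^n(v_0)$. -/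

import Mathlib

open Set Filter

namespace CutProject

noncomputable section

/-- `x` is a quadratic number: its minimal polynomial over `ℚ` has degree two
(in particular `x` is algebraic and irrational). -/
def IsQuadratic (x : ℝ) : Prop := (minpoly ℚ x).natDegree = 2

/-- The algebraic conjugate `x'` of a real quadratic number `x`: if the minimal polynomial is
`X ^ 2 + b X + d`, the other root is `-b - x`. -/
def conj (x : ℝ) : ℝ := -((minpoly ℚ x).coeff 1 : ℝ) - x

/-- The abelian group `ℤ[ε] = {a + b ε | a, b ∈ ℤ}`. -/
def zSpan (ε : ℝ) : Set ℝ := {x | ∃ a b : ℤ, x = a + b * ε}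

/-- The cut-and-project set `Σ_{ε,η}(Ω) = {a + b η | a, b ∈ ℤ, a + b ε ∈ Ω}`. -/
def cpSet (ε η : ℝ) (Ω : Set ℝ) : Set ℝ :=
  {x | ∃ a b : ℤ, (a : ℝ) + b * ε ∈ Ω ∧ x = a + b * η}

/-- The letters coding the distances between neighbours. -/
inductive Letter : Type
  | A
  | B
  | C

/-- The distance coded by a letter: `A ↦ Δ₁`, `B ↦ Δ₁ + Δ₂`, `C ↦ Δ₂`. -/
def gap (Δ₁ Δ₂ : ℝ) : Letter → ℝ
  | Letter.A => Δ₁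
  | Letter.B => Δ₁ + Δ₂
  | Letter.C => Δ₂

/-- `u` is the pointed bidirectional word coding the order of the distances between neighbours in
`Λ ∋ 0`: the set `Λ` is enumerated increasingly as `(x n)` with `x 0 = 0`, the distances that occur
are exactly `Δ₁`, `Δ₂` and `Δ₁ + Δ₂`, and `u n` is the letter of the distance `x (n + 1) - x n`. -/
def IsGapWord (Λ : Set ℝ) (Δ₁ Δ₂ : ℝ) (u : ℤ → Letter) : Prop :=
  ∃ x : ℤ → ℝ, StrictMono x ∧ range x = Λ ∧ x 0 = 0 ∧
    range (fun n : ℤ => x (n + 1) - x n) = {Δ₁, Δ₂, Δ₁ + Δ₂} ∧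
    ∀ n : ℤ, x (n + 1) - x n = gap Δ₁ Δ₂ (u n)

/-- The acceptance window `Ω = [c, c + ℓ)`. -/
def window (c ℓ : ℝ) : Set ℝ := Ico c (c + ℓ)

/-- `u = u_{ε,η}[c, c + ℓ)`. For `ε ∈ (-1, 0)`, `η > 0` and `max (-ε) (1 + ε) < ℓ < 1` the
distances in the cut-and-project set are `Δ₁ = 1 + η` and `Δ₂ = η`, whose star images are
`1 + ε > 0` and `ε < 0`, together with their sum `1 + 2 η`. -/
def IsCutProjectWord (ε η c ℓ : ℝ) (u : ℤ → Letter) : Prop :=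
  IsGapWord (cpSet ε η (window c ℓ)) (1 + η) η u

/-- The three intervals of continuity `Ω_A`, `Ω_B`, `Ω_C` of the stepping function. -/
def piece (ε c ℓ : ℝ) : Letter → Set ℝ
  | Letter.A => Ico c (c + ℓ - 1 - ε)
  | Letter.B => Ico (c + ℓ - 1 - ε) (c - ε)
  | Letter.C => Ico (c - ε) (c + ℓ)

/-- The stepping function `f` of the window `[c, c + ℓ)`; only its values on the window matter. -/
def step (ε c ℓ : ℝ) (y : ℝ) : ℝ :=
  if y < c + ℓ - 1 - ε then y + 1 + ε
  else if y < c - ε then y + 1 + 2 * ε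
  else y + ε

/-- The inverse of the stepping function, as a map of the window to itself. -/
def stepInv (ε c ℓ : ℝ) : ℝ → ℝ := Function.invFunOn (step ε c ℓ) (window c ℓ)

/-- The scaled window `γ Ω`. -/
def scaled (γ c ℓ : ℝ) : Set ℝ := (fun x => γ * x) '' window c ℓ

/-- Step 1: `γ ∈ (0, 1)` is a quadratic unit with `γ ℤ[ε] = ℤ[ε]` and conjugate `γ' > 1`. -/
structure IsAdmissibleUnit (ε γ : ℝ) : Prop where
  quadratic : IsQuadratic γ
  integral : IsIntegral ℤ γ
  integral_inv : IsIntegral ℤ γ⁻¹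
  pos : 0 < γ
  lt_one : γ < 1
  map_zSpan : (fun x => γ * x) '' zSpan ε = zSpan ε
  one_lt_conj : 1 < conj γ

/-- `ind(x) = min {i ∈ ℕ₀ | f⁻ⁱ(x) ∈ γ Ω}`. -/
def ind (ε c ℓ γ x : ℝ) : ℕ := sInf {i : ℕ | (stepInv ε c ℓ)^[i] x ∈ scaled γ c ℓ}

/-- `g_γ(x) = γ⁻¹ f^{-ind(x)}(x)`. -/
def gMap (ε c ℓ γ x : ℝ) : ℝ := γ⁻¹ * (stepInv ε c ℓ)^[ind ε c ℓ γ x] x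

/-- The subsets of the window that contain the left ends of the three intervals of continuity and
are mapped to themselves by `g_γ`. -/
def closedSets (ε c ℓ γ : ℝ) : Set (Set ℝ) :=
  {T | T ⊆ window c ℓ ∧ {c, c + ℓ - 1 - ε, c - ε} ⊆ T ∧ MapsTo (gMap ε c ℓ γ) T T}

/-- The cell `[c_i, c_{i+1})`. -/
def cell {k : ℕ} (cs : Fin (k + 2) → ℝ) (i : Fin (k + 1)) : Set ℝ := Ico (cs i.castSucc) (cs i.succ)

/-- Steps 2 to 5 of the algorithm for the unit `γ`: the division points `c_0 < ⋯ < c_k < c_{k+1}`,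
the morphism `φ` on words over the alphabet `{0, …, k}` (given by the images of the letters), the
initial letters `v_{-1}` and `v_0`, and the letter projection `ψ`. Each of these is determined
uniquely by the fields. -/
structure IsOutput (ε c ℓ γ : ℝ) {k : ℕ} (cs : Fin (k + 2) → ℝ)
    (φ : Fin (k + 1) → List (Fin (k + 1))) (vm v0 : Fin (k + 1)) (ψ : Fin (k + 1) → Letter) :
    Prop where
  strictMono : StrictMono cs
  /-- `S = {c_0, …, c_k}` is the smallest of the closed sets. -/
  isLeast : IsLeast (closedSets ε c ℓ γ) (range fun i : Fin (k + 1) => cs i.castSucc)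
  last : cs (Fin.last (k + 1)) = c + ℓ
  /-- The length of `φ(i)` is `j_i`, the first return time of `γ c_i` to `γ Ω`. -/
  length : ∀ i : Fin (k + 1),
    IsLeast {j : ℕ | 1 ≤ j ∧ (step ε c ℓ)^[j] (γ * cs i.castSucc) ∈ scaled γ c ℓ} (φ i).length
  /-- The `j`-th letter of `φ(i)` names the cell that contains `f^j(γ c_i)`. -/
  letters : ∀ (i : Fin (k + 1)) (j : ℕ) (hj : j < (φ i).length),
    (step ε c ℓ)^[j] (γ * cs i.castSucc) ∈ cell cs ((φ i)[j])
  mem_v0 : (0 : ℝ) ∈ cell cs v0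
  mem_vm : stepInv ε c ℓ 0 ∈ cell cs vm
  proj : ∀ i : Fin (k + 1), cs i.castSucc ∈ piece ε c ℓ (ψ i)

/-- The morphism on finite words determined by the images `φ` of the letters. -/
def morph {β : Type*} (φ : β → List β) (w : List β) : List β := w.flatMap φ

/-- The finite word `v_0 v_1 ⋯ v_{N-1}`. -/
def rightWord {β : Type*} (v : ℤ → β) (N : ℕ) : List β :=
  (List.range N).map fun i => v (i : ℤ)

/-- The finite word `v_{-N} ⋯ v_{-2} v_{-1}`. -/
def leftWord {β : Type*} (v : ℤ → β) (N : ℕ) : List β :=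
  (List.range N).map fun i => v ((i : ℤ) - (N : ℤ))

/-- `v = φ(v)` as pointed bidirectional words: the image of every block of `v` that begins, or
ends, at the origin is again such a block. -/
def IsFixedWord {β : Type*} (φ : β → List β) (v : ℤ → β) : Prop :=
  ∀ N : ℕ,
    morph φ (rightWord v N) = rightWord v (morph φ (rightWord v N)).length ∧
    morph φ (leftWord v N) = leftWord v (morph φ (leftWord v N)).length

/-- `v = lim φⁿ(a) | φⁿ(b)`: the pointed word `v` begins with `a | b`, the images of `a` and `b`
have more than one letter, `v` is invariant under `φ`, and for every `N` all the words `φⁿ(a)` and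
`φⁿ(b)` with `n` large end, respectively begin, with the `N` letters of `v` next to the origin. -/
structure IsLimitWord {β : Type*} (φ : β → List β) (a b : β) (v : ℤ → β) : Prop where
  left_letter : v (-1) = a
  right_letter : v 0 = b
  one_lt_left : 1 < (φ a).length
  one_lt_right : 1 < (φ b).length
  fixed : IsFixedWord φ v
  tendsto : ∀ N : ℕ, ∀ᶠ n : ℕ in atTop,
    leftWord v N <:+ (morph φ)^[n] [a] ∧ rightWord v N <+: (morph φ)^[n] [b]

end

end CutProject

namespace CutProject

/-! The stepping function `f` exchanges three intervals, and the orbit of a point `y` is exactly the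
part of the coset `y + ℤ[ε]` inside the window. Each step adds `a + bε` with `a ≥ 0` and `b ≥ 1`.
Since `τ = ε'` is positive, the conjugate `a + bτ` increases strictly along an orbit and so recovers
its order (`conj_pos_iff`, `exists_zpow_eq`).

Multiplication by `γ` permutes `ℤ[ε]` and multiplies conjugates by `γ' > 0`. It therefore carries
the orbit of `y`, in order, onto the visits of the orbit of `γy` to `γΩ`, so the first return map to
`γΩ` is conjugate to `f` by `γ` (`exists_first_return`).

Finiteness of `S` is a contraction argument on conjugates. The backward walk to `γΩ` changes the
conjugate by a bounded amount (`exists_backward_hit`), and division by `γ` then divides it by `γ' >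
1`. Points with a fixed denominator and a suitably bounded conjugate form an invariant set, and only
finitely many lie in the window (`exists_finite_closedSet`).

Closure of `S` under `g_γ` makes each scaled cell move rigidly through whole cells until it returns
(`orbit_scaled_cell`). Hence `φ(i)` is the itinerary of `γy` for every `y` in cell `i`. As `γ · 0 =
0`, the itinerary `v` of `0` is cut into the blocks `φ(v_n)` and is fixed by `φ`. Replacing `ε` by
`η` in the coordinates of the orbit of `0` enumerates the cut-and-project set (`isCutProjectWord`).
-/

/-! ### Quadratic numbers, conjugates and coordinates. -/

theorem conj_eq_of_root {x : ℝ} (hx : IsQuadratic x) {b d : ℚ} (h : x ^ 2 + b * x + d = 0) :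
    conj x = -b - x := by
  have hdeg : (minpoly ℚ x).natDegree = 2 := hx
  have hint : IsIntegral ℚ x := by
    by_contra hn
    rw [minpoly.eq_zero hn] at hdeg
    simp at hdeg
  set p : Polynomial ℚ := Polynomial.X ^ 2 + Polynomial.C b * Polynomial.X + Polynomial.C d with hp
  have hpm : p.Monic := by rw [hp]; monicity!
  have hpd : p.natDegree = 2 := by rw [hp]; compute_degree!
  have hpx : Polynomial.aeval x p = 0 := by simp [hp, h]
  have heq : p = minpoly ℚ x :=
    Polynomial.eq_of_monic_of_dvd_of_natDegree_le (minpoly.monic hint) hpm (minpoly.dvd ℚ x hpx)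
      (by rw [hpd, hdeg])
  have hc : (minpoly ℚ x).coeff 1 = b := by
    rw [← heq, hp]
    simp [Polynomial.coeff_C]
  simp [conj, hc]

theorem IsQuadratic.exists_root {x : ℝ} (hx : IsQuadratic x) :
    ∃ b d : ℚ, x ^ 2 + b * x + d = 0 := by
  have hdeg : (minpoly ℚ x).natDegree = 2 := hx
  have hint : IsIntegral ℚ x := by
    by_contra hn
    rw [minpoly.eq_zero hn] at hdeg
    simp at hdeg
  have hm : (minpoly ℚ x).coeff 2 = 1 := by
    have := (minpoly.monic hint).coeff_natDegree
    rwa [hdeg] at this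
  have h0 := minpoly.aeval ℚ x
  rw [Polynomial.aeval_eq_sum_range, hdeg] at h0
  simp only [Finset.sum_range_succ, Finset.sum_range_zero, hm, Algebra.smul_def] at h0
  refine ⟨(minpoly ℚ x).coeff 1, (minpoly ℚ x).coeff 0, ?_⟩
  simp at h0
  linarith

theorem IsQuadratic.irrational {x : ℝ} (hx : IsQuadratic x) : Irrational x := by
  rintro ⟨r, rfl⟩
  have hdeg : (minpoly ℚ (r : ℝ)).natDegree = 2 := hx
  have := minpoly.eq_X_sub_C ℝ r
  simp only [eq_ratCast] at this
  rw [this] at hdeg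
  simp at hdeg

theorem isQuadratic_of_root {x : ℝ} (hx : Irrational x) {b d : ℚ}
    (h : x ^ 2 + b * x + d = 0) : IsQuadratic x := by
  set p : Polynomial ℚ := Polynomial.X ^ 2 + Polynomial.C b * Polynomial.X + Polynomial.C d with hp
  have hpm : p.Monic := by rw [hp]; monicity!
  have hpd : p.natDegree = 2 := by rw [hp]; compute_degree!
  have hpx : Polynomial.aeval x p = 0 := by simp [hp, h]
  have hint : IsIntegral ℚ x := ⟨p, hpm, by simpa [Polynomial.aeval_def] using hpx⟩
  have hle : (minpoly ℚ x).natDegree ≤ 2 :=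
    hpd ▸ Polynomial.natDegree_le_of_dvd (minpoly.dvd ℚ x hpx) hpm.ne_zero
  have h2 : 2 ≤ (minpoly ℚ x).natDegree := by
    rw [minpoly.two_le_natDegree_iff hint]
    rintro ⟨r, rfl⟩
    exact hx ⟨r, by simp⟩
  exact le_antisymm hle h2

/-- The coordinates of a number with respect to `1, x` are unique when `x` is irrational. -/
theorem coord_eq_zero {x : ℝ} (hx : Irrational x) {a b : ℚ} (h : (a : ℝ) + b * x = 0) :
    a = 0 ∧ b = 0 := by
  have hb : b = 0 := by
    by_contra hb
    refine hx ⟨-a / b, ?_⟩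
    have : (b : ℝ) ≠ 0 := by exact_mod_cast hb
    push_cast
    field_simp
    linarith
  subst hb
  simpa using h

theorem intCoord_eq {x : ℝ} (hx : Irrational x) {a b a' b' : ℤ}
    (h : (a : ℝ) + b * x = a' + b' * x) : a = a' ∧ b = b' := by
  have := coord_eq_zero hx (a := a - a') (b := b - b') (by push_cast; linarith)
  constructor
  · have h1 := sub_eq_zero.mp this.1
    exact_mod_cast h1
  · have h1 := sub_eq_zero.mp this.2
    exact_mod_cast h1

theorem exists_coord_of_mem_adjoin {ε x : ℝ} (hε : IsQuadratic ε)
    (hx : x ∈ IntermediateField.adjoin ℚ ({ε} : Set ℝ)) : ∃ a b : ℚ, x = a + b * ε := by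
  obtain ⟨b, d, h⟩ := hε.exists_root
  have hint : IsIntegral ℚ ε := by
    by_contra hn
    have hdeg : (minpoly ℚ ε).natDegree = 2 := hε
    rw [minpoly.eq_zero hn] at hdeg
    simp at hdeg
  have hx' : x ∈ Algebra.adjoin ℚ ({ε} : Set ℝ) := by
    rw [← IntermediateField.adjoin_simple_toSubalgebra_of_isAlgebraic hint.isAlgebraic]
    exact hx
  clear hx
  induction hx' using Algebra.adjoin_induction with
  | mem y hy =>
    obtain rfl : y = ε := hy
    exact ⟨0, 1, by simp⟩
  | algebraMap r => exact ⟨r, 0, by simp⟩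
  | add y z hy hz ihy ihz =>
    obtain ⟨a₁, b₁, rfl⟩ := ihy
    obtain ⟨a₂, b₂, rfl⟩ := ihz
    exact ⟨a₁ + a₂, b₁ + b₂, by push_cast; ring⟩
  | mul y z hy hz ihy ihz =>
    obtain ⟨a₁, b₁, rfl⟩ := ihy
    obtain ⟨a₂, b₂, rfl⟩ := ihz
    refine ⟨a₁ * a₂ - b₁ * b₂ * d, a₁ * b₂ + a₂ * b₁ - b₁ * b₂ * b, ?_⟩
    push_cast
    linear_combination (b₁ * b₂ : ℝ) * h

/-! ### Units acting on `ℤ[ε]`. -/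

/-- Multiplication by `γ` is an automorphism of `ℤ[ε]`, which corresponds to the multiplication
by `γ'` of the conjugates `a + b τ`. -/
structure IsScaling (ε τ γ γ' : ℝ) : Prop where
  fwd : ∀ a b : ℤ, ∃ a₁ b₁ : ℤ, γ * (a + b * ε) = a₁ + b₁ * ε ∧ γ' * (a + b * τ) = a₁ + b₁ * τ
  bwd : ∀ a b : ℤ, ∃ a₁ b₁ : ℤ, γ * (a₁ + b₁ * ε) = a + b * ε ∧ γ' * (a₁ + b₁ * τ) = a + b * τ

theorem IsAdmissibleUnit.isScaling {ε γ : ℝ} (hε : IsQuadratic ε) (hγ : IsAdmissibleUnit ε γ) :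
    IsScaling ε (conj ε) γ (conj γ) := by
  obtain ⟨b, d, h⟩ := hε.exists_root
  have hτ := conj_eq_of_root hε h
  set τ := conj ε with hτdef
  have hroot : τ ^ 2 + b * τ + d = 0 := by rw [hτ]; linear_combination h
  have hmem : ∀ z ∈ zSpan ε, γ * z ∈ zSpan ε := fun z hz => by
    rw [← hγ.map_zSpan]
    exact mem_image_of_mem _ hz
  obtain ⟨p, q, hpq⟩ := hmem 1 ⟨1, 0, by simp⟩
  obtain ⟨r, s, hrs⟩ := hmem ε ⟨0, 1, by simp⟩
  rw [mul_one] at hpq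
  -- Computing `γε` both as `r + sε` and as `(p + qε)ε` expresses the matrix of `γ` through `p` and
  -- `q`; the number `p + qτ` acts on `1, τ` by the same matrix.
  have hcoord := coord_eq_zero hε.irrational (a := r + q * d) (b := s - p + q * b) (by
    push_cast
    have : (p + q * ε) * ε = r + s * ε := by rw [← hpq]; exact hrs
    linear_combination (-1 : ℝ) * this + (q : ℝ) * h)
  have h1 : (r : ℝ) + q * d = 0 := by exact_mod_cast hcoord.1
  have h2 : (s : ℝ) - p + q * b = 0 := by exact_mod_cast hcoord.2
  have hγ' : conj γ = p + q * τ := by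
    rw [conj_eq_of_root hγ.quadratic (b := -(2 * p - q * b)) (d := p ^ 2 - p * q * b + q ^ 2 * d)
      (by rw [hpq]; push_cast; linear_combination (q ^ 2 : ℝ) * h), hpq, hτ]
    push_cast
    ring
  have hfwd : ∀ a b : ℤ, ∃ a₁ b₁ : ℤ,
      γ * (a + b * ε) = a₁ + b₁ * ε ∧ conj γ * (a + b * τ) = a₁ + b₁ * τ := by
    intro x y
    refine ⟨x * p + y * r, x * q + y * s, ?_, ?_⟩
    · push_cast
      linear_combination (x : ℝ) * hpq + (y : ℝ) * hrs
    · rw [hγ']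
      push_cast
      linear_combination (y * q : ℝ) * hroot - (y * τ) * h2 - y * h1
  refine ⟨hfwd, fun x y => ?_⟩
  have hxy : (x + y * ε : ℝ) ∈ (fun x => γ * x) '' zSpan ε := by
    rw [hγ.map_zSpan]
    exact ⟨x, y, rfl⟩
  obtain ⟨_, ⟨x₁, y₁, rfl⟩, hz⟩ := hxy
  obtain ⟨x₂, y₂, hx₂, hy₂⟩ := hfwd x₁ y₁
  obtain ⟨rfl, rfl⟩ := intCoord_eq hε.irrational (hx₂.symm.trans hz)
  exact ⟨x₁, y₁, hx₂, hy₂⟩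

theorem IsQuadratic.exists_int_root {x : ℝ} (hx : IsQuadratic x) :
    ∃ A B C : ℤ, A ≠ 0 ∧ (A : ℝ) * x ^ 2 + B * x + C = 0 := by
  obtain ⟨b, d, h⟩ := hx.exists_root
  refine ⟨b.den * d.den, b.num * d.den, d.num * b.den, by positivity, ?_⟩
  have hb : (b : ℝ) * b.den = b.num := by exact_mod_cast Rat.mul_den_eq_num b
  have hd : (d : ℝ) * d.den = d.num := by exact_mod_cast Rat.mul_den_eq_num d
  push_cast
  rw [← hb, ← hd]
  linear_combination (b.den * d.den : ℝ) * h

/-- The Pell equation for the discriminant `D` supplies the unit `t - uδ`, where `δ² = D`; its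
conjugate `t + uδ` is also its inverse. Although `ε` need not be integral, `δ` preserves `ℤ[ε]`,
because `δ = B + 2Aε` and `δε = -2C - Bε`. -/
theorem exists_isAdmissibleUnit {ε : ℝ} (hε : IsQuadratic ε) : ∃ γ : ℝ, IsAdmissibleUnit ε γ := by
  obtain ⟨A, B, C, hA, h⟩ := hε.exists_int_root
  set δ : ℝ := 2 * A * ε + B with hδ
  have hδirr : Irrational δ := by
    rintro ⟨r, hr⟩
    have := coord_eq_zero hε.irrational (a := B - r) (b := 2 * A) (by
      push_cast; rw [hr, hδ]; ring)
    exact hA (by simpa using this.2)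
  have hδ2 : δ ^ 2 = ((B ^ 2 - 4 * A * C : ℤ) : ℝ) := by
    push_cast; rw [hδ]; linear_combination (4 * A : ℝ) * h
  set D : ℤ := B ^ 2 - 4 * A * C with hD
  have hDpos : 0 < D := by
    have : 0 < δ ^ 2 := by have := hδirr.ne_zero; positivity
    rw [hδ2] at this
    exact_mod_cast this
  have hDsq : ¬ IsSquare D := by
    rintro ⟨m, hm⟩
    have : (δ - m) * (δ + m) = 0 := by
      have : δ ^ 2 = m * m := by rw [hδ2, hm]; push_cast; ring
      linear_combination this
    rcases mul_eq_zero.mp this with h0 | h0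
    · exact hδirr ⟨m, by push_cast; linarith⟩
    · exact hδirr ⟨-m, by push_cast; linarith⟩
  -- The sign of `u` is chosen so that `uδ > 0`, which makes `t + uδ` the factor larger than `1`.
  obtain ⟨t, u, htu, htpos, hupos⟩ : ∃ t u : ℤ, t ^ 2 - D * u ^ 2 = 1 ∧ 0 < t ∧ 0 < u * δ := by
    obtain ⟨t, u, htu, hu⟩ := Pell.exists_of_not_isSquare hDpos hDsq
    have ht : t ≠ 0 := by
      rintro rfl
      nlinarith [sq_nonneg u]
    have hu' : (u : ℝ) * δ ≠ 0 := mul_ne_zero (by exact_mod_cast hu) hδirr.ne_zero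
    rcases lt_or_gt_of_ne hu' with h1 | h1
    · exact ⟨|t|, -u, by rw [sq_abs]; linarith, by positivity, by push_cast; linarith⟩
    · exact ⟨|t|, u, by rw [sq_abs]; linarith, by positivity, h1⟩
  have hu0 : u ≠ 0 := by rintro rfl; simp at hupos
  have hnorm : (t - u * δ) * (t + u * δ) = 1 := by
    have : (t : ℝ) ^ 2 - D * u ^ 2 = 1 := by exact_mod_cast htu
    linear_combination this - (u : ℝ) ^ 2 * hδ2
  have ht1 : (1 : ℝ) ≤ t := by exact_mod_cast htpos
  have hgt : 1 < t + u * δ := by linarith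
  have hpos : 0 < t - u * δ := by
    by_contra hn
    nlinarith
  have hirr : Irrational (t - u * δ) := by
    rintro ⟨r, hr⟩
    have := coord_eq_zero hδirr (a := t - r) (b := -u) (by push_cast; linarith)
    exact hu0 (by simpa using this.2)
  have hroot : (t - u * δ) ^ 2 + ((-(2 * t) : ℚ) : ℝ) * (t - u * δ) + ((1 : ℚ) : ℝ) = 0 := by
    push_cast
    linear_combination -hnorm
  have hinv : (t - u * δ)⁻¹ = t + u * δ := inv_eq_of_mul_eq_one_right hnorm
  have hint : ∀ z : ℝ, z ^ 2 - 2 * t * z + 1 = 0 → IsIntegral ℤ z := by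
    intro z hz
    refine ⟨Polynomial.X ^ 2 + Polynomial.C (-(2 * t)) * Polynomial.X + Polynomial.C 1,
      by monicity!, ?_⟩
    simp only [Polynomial.eval₂_add, Polynomial.eval₂_mul, Polynomial.eval₂_pow,
      Polynomial.eval₂_C, Polynomial.eval₂_X]
    simp
    linarith
  have hq := isQuadratic_of_root hirr hroot
  have hmul : ∀ (w : ℤ) (z : ℝ), z ∈ zSpan ε → (t + w * δ) * z ∈ zSpan ε := by
    rintro w _ ⟨a, b, rfl⟩
    refine ⟨t * a + w * B * a - 2 * w * C * b, 2 * w * A * a + t * b - w * B * b, ?_⟩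
    push_cast
    rw [hδ]
    linear_combination (2 * w * b : ℝ) * h
  refine ⟨t - u * δ, hq, hint _ (by linear_combination -hnorm), ?_, hpos, by nlinarith, ?_, ?_⟩
  · rw [hinv]
    exact hint _ (by linear_combination -hnorm)
  · apply Subset.antisymm
    · rintro _ ⟨z, hz, rfl⟩
      have := hmul (-u) z hz
      push_cast at this
      convert this using 1
      ring
    · intro z hz
      exact ⟨(t + u * δ) * z, hmul u z hz, by
        show (t - u * δ) * ((t + u * δ) * z) = z
        rw [← mul_assoc, hnorm, one_mul]⟩
  · rw [conj_eq_of_root hq hroot]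
    push_cast
    linarith

/-! ### The stepping function and its orbits. -/

/-- The translated pieces tile the window in reverse order: `[c, c+ℓ+ε)` comes from `C`, `[c+ℓ+ε,
c+1+ε)` from `B` and `[c+1+ε, c+ℓ)` from `A`. -/
theorem step_bijOn {ε c ℓ : ℝ} (h₁ : -ε < ℓ) (h₂ : 1 + ε < ℓ) (h₃ : ℓ < 1) :
    BijOn (step ε c ℓ) (window c ℓ) (window c ℓ) := by
  refine ⟨?_, ?_, ?_⟩
  · rintro y ⟨hy₁, hy₂⟩
    unfold step window
    split_ifs <;> constructor <;> linarith
  · rintro x ⟨hx₁, hx₂⟩ y ⟨hy₁, hy₂⟩ h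
    unfold step at h
    split_ifs at h <;> linarith
  · rintro y ⟨hy₁, hy₂⟩
    by_cases hA : c + 1 + ε ≤ y
    · refine ⟨y - 1 - ε, ⟨by linarith, by linarith⟩, ?_⟩
      rw [step, if_pos (by linarith)]
      ring
    · by_cases hB : c + ℓ + ε ≤ y
      · refine ⟨y - 1 - 2 * ε, ⟨by linarith, by linarith⟩, ?_⟩
        rw [step, if_neg (by linarith), if_pos (by linarith)]
        ring
      · refine ⟨y - ε, ⟨by linarith, by linarith⟩, ?_⟩
        rw [step, if_neg (by linarith), if_neg (by linarith)]
        ring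

/-- A window, the permutation `e` of the window given by the stepping function, and the
multiplication `σ` by `γ` on the window, together with the conjugates `τ` of `ε` and `γ'` of `γ`. -/
structure IsSystem (ε τ c ℓ γ γ' : ℝ) (e : Equiv.Perm (window c ℓ))
    (σ : window c ℓ → window c ℓ) : Prop extends IsScaling ε τ γ γ' where
  neg_one_lt : -1 < ε
  neg : ε < 0
  irrational : Irrational ε
  conj_pos : 0 < τ
  left_nonpos : c ≤ 0
  right_pos : 0 < c + ℓ
  neg_lt_length : -ε < ℓ
  one_add_lt_length : 1 + ε < ℓ
  length_lt_one : ℓ < 1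
  scale_pos : 0 < γ
  scale_lt_one : γ < 1
  one_lt_conj_scale : 1 < γ'
  coe_perm : ∀ y, (e y : ℝ) = step ε c ℓ y
  coe_scale : ∀ y, (σ y : ℝ) = γ * y

namespace IsSystem

variable {ε τ c ℓ γ γ' : ℝ} {e : Equiv.Perm (window c ℓ)} {σ : window c ℓ → window c ℓ}

theorem exists_step (S : IsSystem ε τ c ℓ γ γ' e σ) (y : window c ℓ) :
    ∃ a b : ℤ, (e y : ℝ) = y + (a + b * ε) ∧ 0 ≤ a ∧ 1 ≤ b := by
  rw [S.coe_perm, step]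
  split_ifs
  · exact ⟨1, 1, by push_cast; ring, by norm_num, by norm_num⟩
  · exact ⟨1, 2, by push_cast; ring, by norm_num, by norm_num⟩
  · exact ⟨0, 1, by push_cast; ring, by norm_num, by norm_num⟩

theorem exists_pow (S : IsSystem ε τ c ℓ γ γ' e σ) (y : window c ℓ) (n : ℕ) :
    ∃ a b : ℤ, ((e ^ n) y : ℝ) = y + (a + b * ε) ∧ 0 ≤ a ∧ n ≤ b := by
  induction n with
  | zero => exact ⟨0, 0, by simp, le_rfl, le_rfl⟩
  | succ n ih =>
    obtain ⟨a, b, h, ha, hb⟩ := ih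
    obtain ⟨a', b', h', ha', hb'⟩ := S.exists_step ((e ^ n) y)
    refine ⟨a + a', b + b', ?_, by positivity, by push_cast; omega⟩
    rw [pow_succ', Equiv.Perm.mul_apply, h', h]
    push_cast
    ring

theorem exists_zpow (S : IsSystem ε τ c ℓ γ γ' e σ) (y : window c ℓ) (n : ℤ) :
    ∃ a b : ℤ, ((e ^ n) y : ℝ) = y + (a + b * ε) ∧
      (0 ≤ n → 0 ≤ a ∧ n ≤ b) ∧ (n ≤ 0 → a ≤ 0 ∧ b ≤ n) := by
  rcases le_total 0 n with hn | hn
  · lift n to ℕ using hn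
    obtain ⟨a, b, h, ha, hb⟩ := S.exists_pow y n
    rcases Nat.eq_zero_or_pos n with rfl | hn
    · exact ⟨0, 0, by simp, by simp, by simp⟩
    · exact ⟨a, b, by simpa using h, fun _ => ⟨ha, hb⟩, fun h => by omega⟩
  · obtain ⟨m, rfl⟩ : ∃ m : ℕ, n = -m := ⟨n.natAbs, by omega⟩
    obtain ⟨a, b, h, ha, hb⟩ := S.exists_pow ((e ^ (-(m : ℤ))) y) m
    have hy : (e ^ m) ((e ^ (-(m : ℤ))) y) = y := by
      rw [← zpow_natCast, ← Equiv.Perm.mul_apply, ← zpow_add]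
      simp
    rw [hy] at h
    rcases Nat.eq_zero_or_pos m with rfl | hm
    · exact ⟨0, 0, by simp, by simp, by simp⟩
    · exact ⟨-a, -b, by push_cast; linarith, fun h => by omega, fun _ => ⟨by omega, by omega⟩⟩

theorem coord_unique (S : IsSystem ε τ c ℓ γ γ' e σ) {y : ℝ} {a b a' b' : ℤ}
    (h : y + (a + b * ε) = y + (a' + b' * ε)) : a = a' ∧ b = b' :=
  intCoord_eq S.irrational (add_left_cancel h)

theorem conj_pos_of_pos (S : IsSystem ε τ c ℓ γ γ' e σ) {y : window c ℓ} {n : ℤ} {a b : ℤ}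
    (h : ((e ^ n) y : ℝ) = y + (a + b * ε)) (hn : 0 < n) : 0 < a + b * τ := by
  obtain ⟨a', b', h', hp, -⟩ := S.exists_zpow y n
  obtain ⟨rfl, rfl⟩ := S.coord_unique (h.symm.trans h')
  obtain ⟨ha, hb⟩ := hp hn.le
  have ha' : (0 : ℝ) ≤ a := by exact_mod_cast ha
  have hb' : (0 : ℝ) < b := by exact_mod_cast hn.trans_le hb
  have := S.conj_pos
  positivity

theorem conj_nonpos_of_nonpos (S : IsSystem ε τ c ℓ γ γ' e σ) {y : window c ℓ} {n : ℤ} {a b : ℤ}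
    (h : ((e ^ n) y : ℝ) = y + (a + b * ε)) (hn : n ≤ 0) : a + b * τ ≤ 0 := by
  obtain ⟨a', b', h', -, hp⟩ := S.exists_zpow y n
  obtain ⟨rfl, rfl⟩ := S.coord_unique (h.symm.trans h')
  obtain ⟨ha, hb⟩ := hp hn
  have ha' : (a : ℝ) ≤ 0 := by exact_mod_cast ha
  have hb' : (b : ℝ) ≤ 0 := by exact_mod_cast hb.trans hn
  have := mul_nonpos_of_nonpos_of_nonneg hb' S.conj_pos.le
  linarith

/-- The position along an orbit can be read off the conjugate of the displacement; all later
comparisons of times use this. -/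
theorem conj_pos_iff (S : IsSystem ε τ c ℓ γ γ' e σ) {y : window c ℓ} {n : ℤ} {a b : ℤ}
    (h : ((e ^ n) y : ℝ) = y + (a + b * ε)) : 0 < a + b * τ ↔ 0 < n :=
  ⟨fun h' => not_le.mp fun hn => (S.conj_nonpos_of_nonpos h hn).not_gt h', S.conj_pos_of_pos h⟩

theorem zpow_injective (S : IsSystem ε τ c ℓ γ γ' e σ) (y : window c ℓ) :
    Function.Injective fun n : ℤ => (e ^ n) y := by
  have key : ∀ n : ℤ, (e ^ n) y = y → n ≤ 0 := by
    intro n hn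
    by_contra hpos
    have := S.conj_pos_of_pos (y := y) (n := n) (a := 0) (b := 0) (by simp [hn]) (not_le.mp hpos)
    simp at this
  intro m n (hmn : (e ^ m) y = (e ^ n) y)
  apply le_antisymm
  · have := key (m - n) (by
      rw [sub_eq_neg_add, zpow_add, Equiv.Perm.mul_apply, hmn, ← Equiv.Perm.mul_apply, ← zpow_add]
      simp)
    omega
  · have := key (n - m) (by
      rw [sub_eq_neg_add, zpow_add, Equiv.Perm.mul_apply, ← hmn, ← Equiv.Perm.mul_apply,
        ← zpow_add]
      simp)
    omega

/-- One step from `y` lowers the remaining coefficient `b` by `1` or `2`, never below zero, and at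
`b = 0` the bound `ℓ < 1` leaves only `x = y`. -/
theorem exists_pow_eq (S : IsSystem ε τ c ℓ γ γ' e σ) (b : ℕ) :
    ∀ (a : ℤ) (y x : window c ℓ), (x : ℝ) = y + (a + b * ε) → ∃ n : ℕ, (e ^ n) y = x := by
  induction b using Nat.strong_induction_on with
  | _ b ih =>
    intro a y x h
    obtain ⟨hx₁, hx₂⟩ := x.2
    obtain ⟨hy₁, hy₂⟩ := y.2
    have hℓ := S.length_lt_one
    have hstep := S.coe_perm y
    have next : ∀ (a₁ : ℤ) (b₁ : ℕ), 0 < b₁ → b₁ ≤ b → (e y : ℝ) = y + (a₁ + b₁ * ε) →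
        ∃ n : ℕ, (e ^ n) y = x := by
      intro a₁ b₁ h₁ hb hy
      obtain ⟨n, hn⟩ := ih (b - b₁) (by omega) (a - a₁) (e y) x (by
        rw [h, hy, Nat.cast_sub hb]
        push_cast
        ring)
      exact ⟨n + 1, by rw [pow_succ, Equiv.Perm.mul_apply, hn]⟩
    rcases Nat.eq_zero_or_pos b with rfl | hb
    · have ha₁ : (a : ℝ) < 1 := by push_cast at h; linarith
      have ha₂ : (-1 : ℝ) < a := by push_cast at h; linarith
      have ha : a = 0 := by
        have h₁ : a < 1 := by exact_mod_cast ha₁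
        have h₂ : -1 < a := by exact_mod_cast ha₂
        omega
      subst ha
      exact ⟨0, Subtype.ext (by simp [h])⟩
    · rw [step] at hstep
      split_ifs at hstep with hA hB
      · exact next 1 1 one_pos hb (by rw [hstep]; push_cast; ring)
      -- From `Ω_B` the point `y + ε` lies left of the window and `y + 1 + ε` is not left of its
      -- right end, so no `y + a + ε` is in the window and `b = 1` is impossible.
      · have hb2 : 2 ≤ b := by
          by_contra hb2
          obtain rfl : b = 1 := by omega
          push_cast at h
          have ha₁ : (0 : ℝ) < a := by linarith
          have ha₂ : (a : ℝ) < 1 := by linarith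
          have h₁ : 0 < a := by exact_mod_cast ha₁
          have h₂ : a < 1 := by exact_mod_cast ha₂
          omega
        exact next 1 2 two_pos hb2 (by rw [hstep]; push_cast; ring)
      · exact next 0 1 one_pos hb (by rw [hstep]; push_cast; ring)

/-- The orbit of `y` is the intersection of the window with the coset `y + ℤ[ε]`. -/
theorem exists_zpow_eq (S : IsSystem ε τ c ℓ γ γ' e σ) {y x : window c ℓ} {a b : ℤ}
    (h : (x : ℝ) = y + (a + b * ε)) : ∃ n : ℤ, (e ^ n) y = x := by
  rcases le_total 0 b with hb | hb
  · lift b to ℕ using hb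
    obtain ⟨n, hn⟩ := S.exists_pow_eq b a y x (by simpa using h)
    exact ⟨n, by simpa using hn⟩
  · obtain ⟨m, rfl⟩ : ∃ m : ℕ, b = -m := ⟨b.natAbs, by omega⟩
    obtain ⟨n, hn⟩ := S.exists_pow_eq m (-a) x y (by rw [h]; push_cast; ring)
    refine ⟨-n, ?_⟩
    rw [← hn, ← zpow_natCast, ← Equiv.Perm.mul_apply, ← zpow_add]
    simp

theorem mem_scaled_iff (S : IsSystem ε τ c ℓ γ γ' e σ) {x : window c ℓ} :
    (x : ℝ) ∈ scaled γ c ℓ ↔ ∃ y, x = σ y := by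
  constructor
  · rintro ⟨y, hy, hyx⟩
    exact ⟨⟨y, hy⟩, Subtype.ext (by rw [S.coe_scale, ← hyx])⟩
  · rintro ⟨y, rfl⟩
    exact ⟨y, y.2, (S.coe_scale y).symm⟩

/-- Scaling multiplies the conjugate of a displacement by `γ' > 0`, so it maps orbits into orbits
and keeps their direction. -/
theorem exists_zpow_scale (S : IsSystem ε τ c ℓ γ γ' e σ) (y : window c ℓ) (n : ℤ) :
    ∃ m : ℤ, (e ^ m) (σ y) = σ ((e ^ n) y) ∧ (0 < n → 0 < m) := by
  obtain ⟨a, b, h, -⟩ := S.exists_zpow y n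
  obtain ⟨a₁, b₁, h₁, h₂⟩ := S.fwd a b
  have hz : (σ ((e ^ n) y) : ℝ) = σ y + (a₁ + b₁ * ε) := by
    rw [S.coe_scale, S.coe_scale, h, ← h₁]
    ring
  obtain ⟨m, hm⟩ := S.exists_zpow_eq hz
  refine ⟨m, hm, fun hn => ?_⟩
  rw [← hm] at hz
  rw [← S.conj_pos_iff hz, ← h₂]
  have := S.conj_pos_of_pos h hn
  have := S.one_lt_conj_scale
  positivity

theorem exists_zpow_of_scale (S : IsSystem ε τ c ℓ γ γ' e σ) {y x : window c ℓ} {m : ℤ}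
    (h : (e ^ m) (σ y) = σ x) (hm : 0 < m) : ∃ n : ℤ, 0 < n ∧ (e ^ n) y = x := by
  obtain ⟨a, b, hab, -⟩ := S.exists_zpow (σ y) m
  obtain ⟨a₁, b₁, h₁, h₂⟩ := S.bwd a b
  have hz : (x : ℝ) = y + (a₁ + b₁ * ε) := by
    apply mul_left_cancel₀ S.scale_pos.ne'
    rw [mul_add, h₁, ← S.coe_scale, ← S.coe_scale, ← h, hab]
  obtain ⟨n, hn⟩ := S.exists_zpow_eq hz
  refine ⟨n, ?_, hn⟩
  rw [← hn] at hz
  rw [← S.conj_pos_iff hz]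
  have := S.conj_pos_of_pos hab hm
  rw [← h₂] at this
  exact pos_of_mul_pos_right this (zero_lt_one.trans S.one_lt_conj_scale).le

/-- The first return map to the scaled window is conjugate to the stepping function. -/
theorem exists_first_return (S : IsSystem ε τ c ℓ γ γ' e σ) (y : window c ℓ) :
    ∃ m : ℕ, 0 < m ∧ (e ^ m) (σ y) = σ (e y) ∧
      ∀ i : ℕ, 0 < i → i < m → ∀ x, (e ^ i) (σ y) ≠ σ x := by
  obtain ⟨m, hm, hpos⟩ := S.exists_zpow_scale y 1
  have hm0 := hpos one_pos
  lift m to ℕ using hm0.le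
  refine ⟨m, by exact_mod_cast hm0, by simpa using hm, ?_⟩
  intro i hi him x hx
  obtain ⟨n, hn, hnx⟩ := S.exists_zpow_of_scale (m := i) (by simpa using hx) (by exact_mod_cast hi)
  -- An earlier visit `σ x` would place `x` strictly between `y` and `e y` on the orbit, writing `1`
  -- as a sum of two positive integers.
  obtain ⟨k, hk, hkx⟩ := S.exists_zpow_of_scale (y := x) (x := e y) (m := m - i) (by
    rw [← hx, ← zpow_natCast, ← Equiv.Perm.mul_apply, ← zpow_add]
    simpa using hm) (by omega)
  have := S.zpow_injective y (a₁ := k + n) (a₂ := 1) (by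
    simp only [zpow_add, Equiv.Perm.mul_apply, hnx, hkx, zpow_one])
  omega

theorem scale_pow (S : IsSystem ε τ c ℓ γ γ' e σ) (a b : ℤ) (N : ℕ) :
    ∃ a₁ b₁ : ℤ, γ ^ N * (a + b * ε) = a₁ + b₁ * ε ∧ γ' ^ N * (a + b * τ) = a₁ + b₁ * τ := by
  induction N with
  | zero => exact ⟨a, b, by simp, by simp⟩
  | succ N ih =>
    obtain ⟨a₁, b₁, h₁, h₂⟩ := ih
    obtain ⟨a₂, b₂, h₃, h₄⟩ := S.fwd a₁ b₁
    exact ⟨a₂, b₂, by rw [← h₃, ← h₁]; ring, by rw [← h₄, ← h₂]; ring⟩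

/-! ### Bounded hitting of subintervals. -/

/-- Every subinterval of the window is reached from every point by a translation by an element of
`ℤ[ε]` whose conjugate is nonpositive and bounded. -/
theorem exists_bounded_translation (S : IsSystem ε τ c ℓ γ γ' e σ) {p q : ℝ} (hpq : p < q)
    (hp : c ≤ p) (hq : q ≤ c + ℓ) :
    ∃ K : ℝ, 0 ≤ K ∧ ∀ x ∈ window c ℓ, ∃ a b : ℤ, x + (a + b * ε) ∈ Ico p q ∧
      -K ≤ a + b * τ ∧ a + b * τ ≤ 0 := by
  have hγ := S.scale_pos
  have hγ' := zero_lt_one.trans S.one_lt_conj_scale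
  have hε := S.neg
  have hε' := S.neg_one_lt
  have hτ := S.conj_pos
  have hℓ := S.length_lt_one
  -- Translations shorter than `q - p` cannot jump over `[p, q)`. The numbers `-εγ^N` (to the right)
  -- and `-γ^N` (to the left) both have negative conjugates, `-τγ'^N` and `-γ'^N`, because `ε < 0 <
  -- τ`.
  obtain ⟨N, hN⟩ := exists_pow_lt_of_lt_one (sub_pos.mpr hpq) S.scale_lt_one
  obtain ⟨a₁, b₁, h₁, h₁'⟩ := S.scale_pow 0 (-1) N
  obtain ⟨a₂, b₂, h₂, h₂'⟩ := S.scale_pow (-1) 0 N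
  push_cast at h₁ h₁' h₂ h₂'
  set t : ℝ := γ ^ N * -ε with ht
  have hs : 0 < γ ^ N := by positivity
  have htpos : 0 < t := mul_pos hs (by linarith)
  have htlt : t < q - p := by nlinarith
  have hγN : 0 < γ' ^ N := by positivity
  -- The factors `1 / t + 1` and `1 / γ ^ N + 1` bound the numbers of translations needed, as the
  -- window is shorter than `1`.
  refine ⟨(1 / t + 1) * (γ' ^ N * τ) + (1 / γ ^ N + 1) * γ' ^ N, by positivity, ?_⟩
  rintro x ⟨hx₁, hx₂⟩
  rcases lt_or_ge x p with hxp | hxp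
  · set k := ⌈(p - x) / t⌉₊ with hk
    have hk₁ : (p - x) / t ≤ k := Nat.le_ceil _
    have hk₂ : (k : ℝ) < (p - x) / t + 1 := Nat.ceil_lt_add_one (by
      have : 0 < p - x := by linarith
      positivity)
    have hk₃ : (p - x) / t ≤ 1 / t := by gcongr; linarith
    have h₃ : p - x ≤ k * t := by rwa [div_le_iff₀ htpos] at hk₁
    have h₄ : k * t < p - x + t := by
      have := mul_lt_mul_of_pos_right hk₂ htpos
      rwa [add_mul, div_mul_cancel₀ _ htpos.ne', one_mul] at this
    have e₁ : ((k * a₁ : ℤ) : ℝ) + ((k * b₁ : ℤ) : ℝ) * ε = k * t := by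
      push_cast
      rw [ht]
      linear_combination (-(k : ℝ)) * h₁
    have e₂ : ((k * a₁ : ℤ) : ℝ) + ((k * b₁ : ℤ) : ℝ) * τ = -(k * (γ' ^ N * τ)) := by
      push_cast
      linear_combination (-(k : ℝ)) * h₁'
    refine ⟨k * a₁, k * b₁, ?_, ?_, ?_⟩
    · rw [e₁]
      constructor <;> linarith
    · rw [e₂]
      have : (k : ℝ) * (γ' ^ N * τ) ≤ (1 / t + 1) * (γ' ^ N * τ) := by
        gcongr
        linarith
      have : 0 ≤ (1 / γ ^ N + 1) * γ' ^ N := by positivity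
      linarith
    · rw [e₂]
      have : 0 ≤ (k : ℝ) * (γ' ^ N * τ) := by positivity
      linarith
  · rcases lt_or_ge x q with hxq | hxq
    · refine ⟨0, 0, by simpa using ⟨hxp, hxq⟩, ?_, by simp⟩
      have : 0 ≤ (1 / t + 1) * (γ' ^ N * τ) + (1 / γ ^ N + 1) * γ' ^ N := by positivity
      simp only [Int.cast_zero, zero_mul, add_zero]
      linarith
    · set k := ⌊(x - q) / γ ^ N⌋₊ with hk
      have hxq' : 0 ≤ (x - q) / γ ^ N := div_nonneg (by linarith) hs.le
      have hk₁ : (k : ℝ) ≤ (x - q) / γ ^ N := Nat.floor_le hxq'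
      have hk₂ : (x - q) / γ ^ N < k + 1 := Nat.lt_floor_add_one _
      have hk₃ : (x - q) / γ ^ N ≤ 1 / γ ^ N := by gcongr; linarith
      have h₃ : k * γ ^ N ≤ x - q := by rwa [le_div_iff₀ hs] at hk₁
      have h₄ : x - q < (k + 1) * γ ^ N := by rwa [div_lt_iff₀ hs] at hk₂
      have e₁ : (((k + 1) * a₂ : ℤ) : ℝ) + (((k + 1) * b₂ : ℤ) : ℝ) * ε = -((k + 1) * γ ^ N) := by
        push_cast
        linear_combination (-(k + 1 : ℝ)) * h₂
      have e₂ : (((k + 1) * a₂ : ℤ) : ℝ) + (((k + 1) * b₂ : ℤ) : ℝ) * τ =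
          -((k + 1) * γ' ^ N) := by
        push_cast
        linear_combination (-(k + 1 : ℝ)) * h₂'
      refine ⟨(k + 1) * a₂, (k + 1) * b₂, ?_, ?_, ?_⟩
      · rw [e₁]
        constructor <;> linarith
      · rw [e₂]
        have : ((k : ℝ) + 1) * γ' ^ N ≤ (1 / γ ^ N + 1) * γ' ^ N := by
          gcongr
          linarith
        have : 0 ≤ (1 / t + 1) * (γ' ^ N * τ) := by positivity
        linarith
      · rw [e₂]
        have : 0 ≤ ((k : ℝ) + 1) * γ' ^ N := by positivity
        linarith

theorem exists_zpow_mem_Ico (S : IsSystem ε τ c ℓ γ γ' e σ) {p q : ℝ} (hpq : p < q)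
    (hp : c ≤ p) (hq : q ≤ c + ℓ) (x : window c ℓ) : ∃ n : ℤ, ((e ^ n) x : ℝ) ∈ Ico p q := by
  obtain ⟨K, -, hK⟩ := S.exists_bounded_translation hpq hp hq
  obtain ⟨a, b, hab, -⟩ := hK x x.2
  obtain ⟨n, hn⟩ := S.exists_zpow_eq (y := x) (x := ⟨_, hp.trans hab.1, hab.2.trans_le hq⟩) rfl
  exact ⟨n, by rwa [hn]⟩

theorem mem_scaled_iff_mem_Ico (S : IsSystem ε τ c ℓ γ γ' e σ) {x : ℝ} :
    x ∈ scaled γ c ℓ ↔ x ∈ Ico (γ * c) (γ * (c + ℓ)) := by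
  have := S.scale_pos
  constructor
  · rintro ⟨y, ⟨h₁, h₂⟩, rfl⟩
    exact ⟨by dsimp only; gcongr, by dsimp only; gcongr⟩
  · rintro ⟨h₁, h₂⟩
    refine ⟨x / γ, ⟨?_, ?_⟩, mul_div_cancel₀ _ this.ne'⟩
    · rw [le_div_iff₀ this]; linarith
    · rw [div_lt_iff₀ this]; linarith

/-- The number of backward steps to the scaled window exists, and the conjugates of the
displacements are bounded. -/
theorem exists_backward_hit (S : IsSystem ε τ c ℓ γ γ' e σ) :
    ∃ K : ℝ, 0 ≤ K ∧ ∀ x : window c ℓ, ∃ i : ℕ, (∃ z, (e ^ (-(i : ℤ))) x = σ z) ∧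
      (∀ j : ℕ, j < i → ∀ z, (e ^ (-(j : ℤ))) x ≠ σ z) ∧
      ∃ a b : ℤ, ((e ^ (-(i : ℤ))) x : ℝ) = x + (a + b * ε) ∧ |a + b * τ| ≤ K := by
  have hγ := S.scale_pos
  have hγ1 := S.scale_lt_one
  have hc := S.left_nonpos
  have hr := S.right_pos
  obtain ⟨K, hK0, hK⟩ := S.exists_bounded_translation (p := γ * c) (q := γ * (c + ℓ))
    (by nlinarith [S.neg_lt_length, S.neg]) (by nlinarith) (by nlinarith)
  refine ⟨K, hK0, fun x => ?_⟩
  obtain ⟨a, b, hab, hlow, hup⟩ := hK x x.2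
  obtain ⟨n, hn⟩ := S.exists_zpow_eq (y := x)
    (x := ⟨_, le_trans (by nlinarith) hab.1, hab.2.trans_le (by nlinarith)⟩) rfl
  have hn' : ((e ^ n) x : ℝ) = x + (a + b * ε) := by rw [hn]
  have hn0 : n ≤ 0 := by
    have := (S.conj_pos_iff hn').not.mp hup.not_gt
    omega
  obtain ⟨m, rfl⟩ : ∃ m : ℕ, n = -m := ⟨n.natAbs, by omega⟩
  have hex : ∃ i : ℕ, ∃ z, (e ^ (-(i : ℤ))) x = σ z :=
    ⟨m, S.mem_scaled_iff.mp (by rw [hn', S.mem_scaled_iff_mem_Ico]; exact hab)⟩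
  classical
  refine ⟨Nat.find hex, Nat.find_spec hex, fun j hj z hz => Nat.find_min hex hj ⟨z, hz⟩, ?_⟩
  have him : Nat.find hex ≤ m :=
    Nat.find_le ⟨_, (S.mem_scaled_iff.mp (by
      rw [hn', S.mem_scaled_iff_mem_Ico]; exact hab)).choose_spec⟩
  set i := Nat.find hex with hi
  obtain ⟨a₁, b₁, h₁, -⟩ := S.exists_zpow x (-(i : ℤ))
  have h₂ : ((e ^ ((i : ℤ) - m)) ((e ^ (-(i : ℤ))) x) : ℝ) =
      (e ^ (-(i : ℤ))) x + ((a - a₁ : ℤ) + (b - b₁ : ℤ) * ε) := by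
    rw [← Equiv.Perm.mul_apply, ← zpow_add, h₁, show (i : ℤ) - m + -i = -m by ring, hn']
    push_cast
    ring
  -- The walk to the bounded hit passes through the first one. Both parts have nonpositive
  -- conjugates with sum at least `-K`, so each is bounded by `K`.
  have h₃ := S.conj_nonpos_of_nonpos h₁ (by omega)
  have h₄ := S.conj_nonpos_of_nonpos h₂ (by omega)
  push_cast at h₄
  exact ⟨a₁, b₁, h₁, abs_le.mpr ⟨by linarith, by linarith⟩⟩

theorem iterate_step (S : IsSystem ε τ c ℓ γ γ' e σ) (y : window c ℓ) (n : ℕ) :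
    (step ε c ℓ)^[n] y = (e ^ n) y := by
  induction n with
  | zero => simp
  | succ n ih =>
    rw [Function.iterate_succ_apply', ih, pow_succ', Equiv.Perm.mul_apply, S.coe_perm]

theorem stepInv_coe (S : IsSystem ε τ c ℓ γ γ' e σ) (y : window c ℓ) :
    stepInv ε c ℓ y = e.symm y := by
  have hb := step_bijOn (c := c) S.neg_lt_length S.one_add_lt_length S.length_lt_one
  have hy := hb.surjOn y.2
  refine hb.injOn (Function.invFunOn_mem hy) (e.symm y).2 ?_
  rw [← S.coe_perm, Equiv.apply_symm_apply]
  exact Function.invFunOn_eq hy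

theorem iterate_stepInv (S : IsSystem ε τ c ℓ γ γ' e σ) (y : window c ℓ) (n : ℕ) :
    (stepInv ε c ℓ)^[n] y = (e ^ (-(n : ℤ))) y := by
  induction n with
  | zero => simp
  | succ n ih =>
    rw [Function.iterate_succ_apply', ih, S.stepInv_coe]
    congr 1
    rw [Nat.cast_succ, neg_add_rev, zpow_add, Equiv.Perm.mul_apply, zpow_neg_one]
    rfl

theorem exists_stepInv_mem (S : IsSystem ε τ c ℓ γ γ' e σ) {x : ℝ} (hx : x ∈ window c ℓ) :
    ∃ i : ℕ, (stepInv ε c ℓ)^[i] x ∈ scaled γ c ℓ := by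
  obtain ⟨K, -, hK⟩ := S.exists_backward_hit
  obtain ⟨i, hi, -⟩ := hK ⟨x, hx⟩
  exact ⟨i, by rw [S.iterate_stepInv ⟨x, hx⟩]; exact S.mem_scaled_iff.mpr hi⟩

theorem gMap_eq (S : IsSystem ε τ c ℓ γ γ' e σ) {x z : window c ℓ} {i : ℕ}
    (hi : (e ^ (-(i : ℤ))) x = σ z) (hmin : ∀ j : ℕ, j < i → ∀ w, (e ^ (-(j : ℤ))) x ≠ σ w) :
    gMap ε c ℓ γ x = z := by
  have hind : ind ε c ℓ γ x = i := by
    apply le_antisymm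
    · refine Nat.sInf_le ?_
      show (stepInv ε c ℓ)^[i] x ∈ scaled γ c ℓ
      rw [S.iterate_stepInv]
      exact S.mem_scaled_iff.mpr ⟨z, hi⟩
    · by_contra hlt
      -- The set of hitting times is nonempty, so the infimum is attained and is not the default
      -- `0`.
      have hmem : ind ε c ℓ γ x ∈ {i : ℕ | (stepInv ε c ℓ)^[i] x ∈ scaled γ c ℓ} :=
        Nat.sInf_mem (S.exists_stepInv_mem x.2)
      rw [mem_ofPred_eq, S.iterate_stepInv, S.mem_scaled_iff] at hmem
      obtain ⟨w, hw⟩ := hmem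
      exact hmin _ (not_le.mp hlt) w hw
  rw [gMap, hind, S.iterate_stepInv, hi, S.coe_scale, inv_mul_cancel_left₀ S.scale_pos.ne']

end IsSystem

/-! ### Finiteness tools and enumeration of division points. -/

/-- The difference of the two bounded quantities is `b(ε - τ)`, which bounds `b` and then `a`. -/
theorem finite_bounded_coord {ε τ : ℝ} (h : ε ≠ τ) (R : ℝ) :
    {x : ℝ | ∃ a b : ℤ, x = a + b * ε ∧ |a + b * ε| ≤ R ∧ |a + b * τ| ≤ R}.Finite := by
  have hd : 0 < |ε - τ| := abs_pos.mpr (sub_ne_zero.mpr h)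
  set M : ℝ := 2 * R / |ε - τ| with hM
  set L : ℤ := ⌈M⌉ with hL
  set L' : ℤ := ⌈R + M * |ε|⌉ with hL'
  refine (((finite_Icc (-L') L').prod (finite_Icc (-L) L)).image
    fun w : ℤ × ℤ => (w.1 : ℝ) + w.2 * ε).subset ?_
  rintro x ⟨a, b, rfl, h₁, h₂⟩
  have hb : |(b : ℝ)| ≤ M := by
    rw [hM, le_div_iff₀ hd, ← abs_mul]
    calc |(b : ℝ) * (ε - τ)| = |(a + b * ε) - (a + b * τ)| := by congr 1; ring
      _ ≤ |a + b * ε| + |a + b * τ| := abs_sub _ _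
      _ ≤ 2 * R := by linarith
  have ha : |(a : ℝ)| ≤ R + M * |ε| := by
    calc |(a : ℝ)| = |(a + b * ε) - b * ε| := by congr 1; ring
      _ ≤ |a + b * ε| + |b * ε| := abs_sub _ _
      _ ≤ R + M * |ε| := by
        rw [abs_mul]
        gcongr
  have hb' : |b| ≤ L := by
    have : ((|b| : ℤ) : ℝ) ≤ L := by push_cast; exact hb.trans (Int.le_ceil _)
    exact_mod_cast this
  have ha' : |a| ≤ L' := by
    have : ((|a| : ℤ) : ℝ) ≤ L' := by push_cast; exact ha.trans (Int.le_ceil _)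
    exact_mod_cast this
  exact ⟨(a, b), ⟨abs_le.mp ha', abs_le.mp hb'⟩, rfl⟩

theorem exists_int_coord {ε x : ℝ} {u v : ℚ} (h : x = u + v * ε) :
    ∃ (q : ℕ) (a b : ℤ), 0 < q ∧ q * x = a + b * ε := by
  refine ⟨u.den * v.den, u.num * v.den, v.num * u.den, by positivity, ?_⟩
  have hu : (u : ℝ) * u.den = u.num := by exact_mod_cast Rat.mul_den_eq_num u
  have hv : (v : ℝ) * v.den = v.num := by exact_mod_cast Rat.mul_den_eq_num v
  push_cast
  rw [← hu, ← hv, h]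
  ring

theorem sInter_mem_closedSets {ε c ℓ γ : ℝ} (h : (closedSets ε c ℓ γ).Nonempty) :
    ⋂₀ closedSets ε c ℓ γ ∈ closedSets ε c ℓ γ := by
  obtain ⟨T, hT⟩ := h
  refine ⟨(sInter_subset_of_mem hT).trans hT.1, subset_sInter fun U hU => hU.2.1, ?_⟩
  intro x hx U hU
  exact hU.2.2 (hx U hU)

theorem exists_enumeration {c r : ℝ} {F : Set ℝ} (hF : F.Finite) (hsub : F ⊆ Ico c r)
    (hne : F.Nonempty) :
    ∃ (k : ℕ) (cs : Fin (k + 2) → ℝ), StrictMono cs ∧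
      (range fun i : Fin (k + 1) => cs i.castSucc) = F ∧ cs (Fin.last (k + 1)) = r := by
  obtain ⟨k, hk⟩ : ∃ k, hF.toFinset.card = k + 1 :=
    Nat.exists_eq_succ_of_ne_zero (by simpa using hne.ne_empty)
  have hrange := Finset.range_orderEmbOfFin hF.toFinset hk
  rw [hF.coe_toFinset] at hrange
  refine ⟨k, Fin.snoc (α := fun _ => ℝ) (hF.toFinset.orderEmbOfFin hk) r, ?_, ?_, ?_⟩
  · intro i j hij
    induction j using Fin.lastCases with
    | last =>
      induction i using Fin.lastCases with
      | last => exact absurd hij (lt_irrefl _)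
      | cast i =>
        rw [Fin.snoc_castSucc, Fin.snoc_last]
        exact (hsub (hrange.subset ⟨i, rfl⟩)).2
    | cast j =>
      induction i using Fin.lastCases with
      | last => exact absurd hij (not_lt.mpr (Fin.le_last _))
      | cast i =>
        rw [Fin.snoc_castSucc, Fin.snoc_castSucc]
        exact (hF.toFinset.orderEmbOfFin hk).strictMono (by simpa using hij)
  · simpa only [Fin.snoc_castSucc] using hrange
  · exact Fin.snoc_last ..

/-! ### Cells and pieces. -/

section Cells

variable {k : ℕ} {cs : Fin (k + 2) → ℝ}

theorem exists_mem_cell {y : ℝ} (h₀ : cs 0 ≤ y) (h₁ : y < cs (Fin.last (k + 1))) :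
    ∃ i, y ∈ cell cs i := by
  by_contra! hn
  have : ∀ i : Fin (k + 2), cs i ≤ y := by
    intro i
    induction i using Fin.induction with
    | zero => exact h₀
    | succ i ih =>
      by_contra hlt
      exact hn i ⟨ih, not_le.mp hlt⟩
  exact (this _).not_gt h₁

theorem cell_unique (hcs : StrictMono cs) {y : ℝ} {i j : Fin (k + 1)} (hi : y ∈ cell cs i)
    (hj : y ∈ cell cs j) : i = j := by
  by_contra hne
  have key : ∀ i j : Fin (k + 1), y ∈ cell cs i → y ∈ cell cs j → ¬ i < j := by
    intro i j hi hj hij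
    have : cs i.succ ≤ cs j.castSucc := hcs.monotone (by
      rw [Fin.le_def]
      simpa using hij)
    linarith [hi.2, hj.1]
  rcases lt_or_gt_of_ne hne with h | h
  · exact key i j hi hj h
  · exact key j i hj hi h

theorem left_mem_cell (hcs : StrictMono cs) (i : Fin (k + 1)) : cs i.castSucc ∈ cell cs i :=
  ⟨le_rfl, hcs i.castSucc_lt_succ⟩

theorem cs_zero_eq {c r : ℝ} (hcs : StrictMono cs)
    (hsub : (range fun i : Fin (k + 1) => cs i.castSucc) ⊆ Ico c r)
    (hc : c ∈ range fun i : Fin (k + 1) => cs i.castSucc) : cs 0 = c := by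
  apply le_antisymm
  · obtain ⟨i, hi⟩ := hc
    exact (hcs.monotone (Fin.zero_le _)).trans hi.le
  · exact (hsub ⟨0, rfl⟩).1

theorem exists_cell_index {c ℓ : ℝ} (hcs : StrictMono cs) (h₀ : cs 0 = c)
    (h₁ : cs (Fin.last (k + 1)) = c + ℓ) :
    ∃ idx : window c ℓ → Fin (k + 1), ∀ (y : window c ℓ) i, (y : ℝ) ∈ cell cs i ↔ idx y = i := by
  have := fun y : window c ℓ => exists_mem_cell (cs := cs) (y := y) (h₀ ▸ y.2.1) (h₁ ▸ y.2.2)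
  choose idx hidx using this
  exact ⟨idx, fun y i => ⟨fun h => cell_unique hcs (hidx y) h, fun h => h ▸ hidx y⟩⟩

end Cells

theorem exists_mem_piece {ε c ℓ y : ℝ} (hy : y ∈ window c ℓ) : ∃ L, y ∈ piece ε c ℓ L := by
  obtain ⟨h₁, h₂⟩ := hy
  by_cases hA : y < c + ℓ - 1 - ε
  · exact ⟨Letter.A, h₁, hA⟩
  · by_cases hB : y < c - ε
    · exact ⟨Letter.B, not_lt.mp hA, hB⟩
    · exact ⟨Letter.C, not_lt.mp hB, h₂⟩

/-! ### The algorithm terminates. -/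

namespace IsSystem

variable {ε τ c ℓ γ γ' : ℝ} {e : Equiv.Perm (window c ℓ)} {σ : window c ℓ → window c ℓ}

/-- After clearing denominators by `q`, the map `g_γ` changes a conjugate `s` into `(s + qδ) / γ'`
with `|δ| ≤ K`. The bound `|s| ≤ R` is preserved once `qK ≤ R(γ' - 1)`. -/
theorem exists_finite_closedSet (S : IsSystem ε τ c ℓ γ γ' e σ) {uc vc ul vl : ℚ}
    (hc : c = uc + vc * ε) (hl : ℓ = ul + vl * ε) : ∃ T ∈ closedSets ε c ℓ γ, T.Finite := by
  obtain ⟨q₁, a₁, b₁, hq₁, h₁⟩ := exists_int_coord hc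
  obtain ⟨q₂, a₂, b₂, hq₂, h₂⟩ := exists_int_coord hl
  obtain ⟨K, hK0, hK⟩ := S.exists_backward_hit
  set q : ℕ := q₁ * q₂ with hq
  have hqpos : (0 : ℝ) < q := by exact_mod_cast Nat.mul_pos hq₁ hq₂
  have hqc : (q : ℝ) * c = ((q₂ * a₁ : ℤ) : ℝ) + ((q₂ * b₁ : ℤ) : ℝ) * ε := by
    rw [hq]; push_cast; linear_combination (q₂ : ℝ) * h₁
  have hql : (q : ℝ) * ℓ = ((q₁ * a₂ : ℤ) : ℝ) + ((q₁ * b₂ : ℤ) : ℝ) * ε := by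
    rw [hq]; push_cast; linear_combination (q₁ : ℝ) * h₂
  generalize (q₂ * a₁ : ℤ) = a₁ at hqc
  generalize (q₂ * b₁ : ℤ) = b₁ at hqc
  generalize (q₁ * a₂ : ℤ) = a₂ at hql
  generalize (q₁ * b₂ : ℤ) = b₂ at hql
  -- The first term ensures invariance; the three absolute values make room for the conjugates of
  -- the required division points.
  set R : ℝ := q * K / (γ' - 1) + |a₁ + b₁ * τ| +
    |((a₁ + a₂ - q : ℤ) : ℝ) + ((b₁ + b₂ - q : ℤ) : ℝ) * τ| +
    |((a₁ : ℤ) : ℝ) + ((b₁ - q : ℤ) : ℝ) * τ| with hR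
  have hγ' := sub_pos.mpr S.one_lt_conj_scale
  have hR₀ : 0 ≤ q * K / (γ' - 1) := by positivity
  have hRK : q * K ≤ R * (γ' - 1) := by
    rw [← div_le_iff₀ hγ', hR]
    have := abs_nonneg (a₁ + b₁ * τ)
    have := abs_nonneg (((a₁ + a₂ - q : ℤ) : ℝ) + ((b₁ + b₂ - q : ℤ) : ℝ) * τ)
    have := abs_nonneg (((a₁ : ℤ) : ℝ) + ((b₁ - q : ℤ) : ℝ) * τ)
    linarith
  set T : Set ℝ := {x | x ∈ window c ℓ ∧ ∃ a b : ℤ, q * x = a + b * ε ∧ |a + b * τ| ≤ R} with hT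
  refine ⟨T, ⟨fun x hx => hx.1, ?_, ?_⟩, ?_⟩
  · have := S.neg; have := S.neg_one_lt; have := S.neg_lt_length; have := S.one_add_lt_length
    have := S.length_lt_one
    have n₁ := abs_nonneg (a₁ + b₁ * τ)
    have n₂ := abs_nonneg (((a₁ + a₂ - q : ℤ) : ℝ) + ((b₁ + b₂ - q : ℤ) : ℝ) * τ)
    have n₃ := abs_nonneg (((a₁ : ℤ) : ℝ) + ((b₁ - q : ℤ) : ℝ) * τ)
    rintro x (rfl | rfl | rfl)
    · exact ⟨⟨le_rfl, by linarith⟩, a₁, b₁, hqc, by linarith⟩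
    · refine ⟨⟨by linarith, by linarith⟩, a₁ + a₂ - q, b₁ + b₂ - q, ?_, by linarith⟩
      push_cast
      linear_combination hqc + hql
    · refine ⟨⟨by linarith, by linarith⟩, a₁, b₁ - q, ?_, by linarith⟩
      push_cast
      linear_combination hqc
  · rintro x ⟨hx, a, b, hab, hbound⟩
    obtain ⟨i, ⟨z, hz⟩, hmin, a', b', hab', hbound'⟩ := hK ⟨x, hx⟩
    rw [show x = ((⟨x, hx⟩ : window c ℓ) : ℝ) from rfl, S.gMap_eq hz hmin]
    obtain ⟨a₃, b₃, h₃, h₄⟩ := S.bwd (a + q * a') (b + q * b')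
    refine ⟨z.2, a₃, b₃, ?_, ?_⟩
    · apply mul_left_cancel₀ S.scale_pos.ne'
      rw [hz, S.coe_scale] at hab'
      rw [h₃]
      push_cast
      linear_combination (q : ℝ) * hab' + hab
    · have hγ'0 : 0 < γ' := by linarith
      refine le_of_mul_le_mul_left ?_ hγ'0
      rw [← abs_of_pos hγ'0, ← abs_mul, h₄, abs_of_pos hγ'0]
      push_cast
      calc |a + q * a' + (b + q * b') * τ| = |(a + b * τ) + q * (a' + b' * τ)| := by congr 1; ring
        _ ≤ |a + b * τ| + |q * (a' + b' * τ)| := abs_add_le _ _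
        _ ≤ R + q * K := by
          rw [abs_mul, abs_of_pos hqpos]
          gcongr
        _ ≤ γ' * R := by linarith
  · have hετ : ε ≠ τ := (S.neg.trans S.conj_pos).ne
    set B : ℝ := q * (|c| + |c + ℓ|) with hB
    refine ((finite_bounded_coord hετ (max B R)).image fun y : ℝ => y / q).subset ?_
    rintro x ⟨⟨hx₁, hx₂⟩, a, b, hab, hbound⟩
    refine ⟨q * x, ⟨a, b, hab, ?_, hbound.trans (le_max_right _ _)⟩, by field_simp⟩
    rw [← hab, abs_mul, abs_of_pos hqpos]
    refine le_trans ?_ (le_max_left _ _)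
    rw [hB]
    gcongr
    rw [abs_le]
    constructor
    · linarith [neg_abs_le c, abs_nonneg (c + ℓ)]
    · linarith [le_abs_self (c + ℓ), abs_nonneg c]

theorem isLeast_return (S : IsSystem ε τ c ℓ γ γ' e σ) {p : window c ℓ} {m : ℕ} (hm : 0 < m)
    (hret : (e ^ m) (σ p) = σ (e p)) (hmin : ∀ i : ℕ, 0 < i → i < m → ∀ x, (e ^ i) (σ p) ≠ σ x) :
    IsLeast {j : ℕ | 1 ≤ j ∧ (step ε c ℓ)^[j] (γ * p) ∈ scaled γ c ℓ} m := by
  rw [← S.coe_scale]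
  constructor
  · refine ⟨hm, ?_⟩
    rw [S.iterate_step]
    exact S.mem_scaled_iff.mpr ⟨_, hret⟩
  · rintro j ⟨hj, hmem⟩
    by_contra hlt
    rw [S.iterate_step, S.mem_scaled_iff] at hmem
    obtain ⟨x, hx⟩ := hmem
    exact hmin j hj (not_le.mp hlt) x hx

theorem exists_isOutput (S : IsSystem ε τ c ℓ γ γ' e σ) {uc vc ul vl : ℚ}
    (hc : c = uc + vc * ε) (hl : ℓ = ul + vl * ε) :
    ∃ (k : ℕ) (cs : Fin (k + 2) → ℝ) (φ : Fin (k + 1) → List (Fin (k + 1)))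
      (vm v0 : Fin (k + 1)) (ψ : Fin (k + 1) → Letter), IsOutput ε c ℓ γ cs φ vm v0 ψ := by
  obtain ⟨T, hT, hTfin⟩ := S.exists_finite_closedSet hc hl
  have hF := sInter_mem_closedSets ⟨T, hT⟩
  have hleast : IsLeast (closedSets ε c ℓ γ) (⋂₀ closedSets ε c ℓ γ) :=
    ⟨hF, fun U hU => sInter_subset_of_mem hU⟩
  have hcF : c ∈ ⋂₀ closedSets ε c ℓ γ := hF.2.1 (by simp)
  obtain ⟨k, cs, hcs, hrange, hlast⟩ := exists_enumeration
    (hTfin.subset (sInter_subset_of_mem hT)) hF.1 ⟨c, hcF⟩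
  rw [← hrange] at hleast hcF hF
  obtain ⟨idx, hidx⟩ := exists_cell_index hcs (cs_zero_eq hcs hF.1 hcF) hlast
  have hmem : ∀ i : Fin (k + 1), cs i.castSucc ∈ window c ℓ := fun i => hF.1 ⟨i, rfl⟩
  choose m hm hret hmin using fun i => S.exists_first_return ⟨_, hmem i⟩
  choose ψ hψ using fun i => exists_mem_piece (ε := ε) (hmem i)
  have h0 : (0 : ℝ) ∈ window c ℓ := ⟨S.left_nonpos, S.right_pos⟩
  refine ⟨k, cs, fun i => (List.range (m i)).map fun j => idx ((e ^ j) (σ ⟨_, hmem i⟩)),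
    idx (e.symm ⟨0, h0⟩), idx ⟨0, h0⟩, ψ, hcs, hleast, hlast, ?_, ?_, ?_, ?_, hψ⟩
  · intro i
    rw [List.length_map, List.length_range]
    exact S.isLeast_return (hm i) (hret i) (hmin i)
  · intro i j hj
    rw [show γ * cs i.castSucc = σ ⟨_, hmem i⟩ from
      (S.coe_scale ⟨_, hmem i⟩).symm, S.iterate_step, hidx]
    simp
  · exact (hidx ⟨0, h0⟩ _).mpr rfl
  · have h := (hidx (e.symm ⟨0, h0⟩) _).mpr rfl
    rwa [← S.stepInv_coe] at h

end IsSystem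

/-! ### Rigid motion of scaled cells. -/

namespace IsOutput

variable {ε τ c ℓ γ γ' : ℝ} {e : Equiv.Perm (window c ℓ)} {σ : window c ℓ → window c ℓ}
  {k : ℕ} {cs : Fin (k + 2) → ℝ} {φ : Fin (k + 1) → List (Fin (k + 1))} {vm v0 : Fin (k + 1)}
  {ψ : Fin (k + 1) → Letter}

theorem left_mem_window (O : IsOutput ε c ℓ γ cs φ vm v0 ψ) (i : Fin (k + 1)) :
    cs i.castSucc ∈ window c ℓ := O.isLeast.1.1 ⟨i, rfl⟩

theorem exists_index (O : IsOutput ε c ℓ γ cs φ vm v0 ψ) :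
    ∃ idx : window c ℓ → Fin (k + 1), ∀ (y : window c ℓ) i, (y : ℝ) ∈ cell cs i ↔ idx y = i :=
  exists_cell_index O.strictMono
    (cs_zero_eq O.strictMono O.isLeast.1.1 (O.isLeast.1.2.1 (by simp))) O.last

/-- No division point lies in the interior of a cell. Applied to the two breakpoints of `f`, this
makes `f` a translation on each cell. -/
theorem lt_iff_of_mem_cell (O : IsOutput ε c ℓ γ cs φ vm v0 ψ) {i : Fin (k + 1)} {y d : ℝ}
    (hy : y ∈ cell cs i) (hd : d ∈ range fun i : Fin (k + 1) => cs i.castSucc) :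
    y < d ↔ cs i.castSucc < d := by
  refine ⟨fun h => hy.1.trans_lt h, fun h => ?_⟩
  obtain ⟨j, rfl⟩ := hd
  have hij : i.castSucc < j.castSucc := O.strictMono.lt_iff_lt.mp h
  refine hy.2.trans_le (O.strictMono.monotone ?_)
  rw [Fin.le_def]
  simpa using hij

theorem step_eq_of_mem_cell (O : IsOutput ε c ℓ γ cs φ vm v0 ψ) {i : Fin (k + 1)} {y : ℝ}
    (hy : y ∈ cell cs i) : step ε c ℓ y = step ε c ℓ (cs i.castSucc) + (y - cs i.castSucc) := by
  have h₁ := O.lt_iff_of_mem_cell hy (d := c + ℓ - 1 - ε) (O.isLeast.1.2.1 (by simp))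
  have h₂ := O.lt_iff_of_mem_cell hy (d := c - ε) (O.isLeast.1.2.1 (by simp))
  simp only [step, h₁, h₂]
  split_ifs <;> ring

theorem mem_piece_of_mem_cell (O : IsOutput ε c ℓ γ cs φ vm v0 ψ) {i : Fin (k + 1)} {y : ℝ}
    (hw : y ∈ window c ℓ) (hy : y ∈ cell cs i) : y ∈ piece ε c ℓ (ψ i) := by
  have h₁ := O.lt_iff_of_mem_cell hy (d := c + ℓ - 1 - ε) (O.isLeast.1.2.1 (by simp))
  have h₂ := O.lt_iff_of_mem_cell hy (d := c - ε) (O.isLeast.1.2.1 (by simp))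
  have hp := O.proj i
  cases hL : ψ i with
  | A => rw [hL] at hp; exact ⟨hw.1, h₁.mpr hp.2⟩
  | B => rw [hL] at hp; exact ⟨not_lt.mp (h₁.not.mpr (not_lt.mpr hp.1)), h₂.mpr hp.2⟩
  | C => rw [hL] at hp; exact ⟨not_lt.mp (h₂.not.mpr (not_lt.mpr hp.1)), hw.2⟩

/-- As long as the orbits of the scaled cell have not returned to the scaled window, they move by
translations, avoid the scaled window and stay in common cells. -/
theorem orbit_scaled_cell (O : IsOutput ε c ℓ γ cs φ vm v0 ψ) (S : IsSystem ε τ c ℓ γ γ' e σ)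
    {idx : window c ℓ → Fin (k + 1)} (hidx : ∀ (y : window c ℓ) i, (y : ℝ) ∈ cell cs i ↔ idx y = i)
    {p : window c ℓ} {i : Fin (k + 1)} (hp : (p : ℝ) = cs i.castSucc) {m : ℕ}
    (hmin : ∀ s : ℕ, 0 < s → s < m → ∀ x, (e ^ s) (σ p) ≠ σ x)
    (s : ℕ) : s ≤ m → ∀ y, idx y = i →
      ((e ^ s) (σ y) : ℝ) = (e ^ s) (σ p) + γ * (y - p) ∧
      (0 < s → s < m → ∀ x, (e ^ s) (σ y) ≠ σ x) ∧
      (s < m → idx ((e ^ s) (σ y)) = idx ((e ^ s) (σ p))) := by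
  have hγ := S.scale_pos
  have hpi : idx p = i := (hidx _ _).mp (hp ▸ left_mem_cell O.strictMono i)
  have hstep : ∀ y z : window c ℓ, idx y = idx z → (e y : ℝ) = e z + (y - z) := by
    intro y z hyz
    rw [S.coe_perm, S.coe_perm, O.step_eq_of_mem_cell ((hidx y _).mpr hyz),
      O.step_eq_of_mem_cell ((hidx z _).mpr rfl)]
    ring
  induction s using Nat.strong_induction_on with
  | _ s ih =>
    intro hs
    have htrans : ∀ y, idx y = i → ((e ^ s) (σ y) : ℝ) = (e ^ s) (σ p) + γ * (y - p) := by
      intro y hy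
      cases s with
      | zero => simp only [pow_zero, Equiv.Perm.one_apply, S.coe_scale]; ring
      | succ s =>
        obtain ⟨h₁, -, h₃⟩ := ih s (by omega) (by omega) y hy
        rw [pow_succ', Equiv.Perm.mul_apply, Equiv.Perm.mul_apply, hstep _ _ (h₃ (by omega)), h₁]
        ring
    -- A hit at time `s` would be the first return of `σ y`, hence at `σ (e y)`; rigid translation
    -- then brings `σ p` to `σ (e p)` at the same time, before its own return.
    have havoid : ∀ y, idx y = i → 0 < s → s < m → ∀ x, (e ^ s) (σ y) ≠ σ x := by
      intro y hy hs0 hsm x hx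
      obtain ⟨m', hm', hret', hmin'⟩ := S.exists_first_return y
      obtain rfl : m' = s := by
        rcases lt_trichotomy m' s with h | h | h
        · exact absurd hret' ((ih m' h (by omega) y hy).2.1 hm' (by omega) _)
        · exact h
        · exact absurd hx (hmin' s hs0 h x)
      refine hmin m' hs0 hsm (e p) (Subtype.ext ?_)
      have h := htrans y hy
      rw [hret', S.coe_scale, hstep y p (hy.trans hpi.symm)] at h
      rw [S.coe_scale]
      linarith
    refine fun y hy => ⟨htrans y hy, havoid y hy, fun hsm => ?_⟩
    have hyc := (hidx y i).mpr hy
    set p' := (e ^ s) (σ p) with hp'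
    have hp'c := (hidx p' _).mpr rfl
    have hle : (p' : ℝ) ≤ (e ^ s) (σ y) := by
      rw [htrans y hy]
      have : 0 ≤ γ * ((y : ℝ) - p) := mul_nonneg hγ.le (by rw [hp]; linarith [hyc.1])
      linarith
    rw [← hidx]
    refine ⟨hp'c.1.trans hle, ?_⟩
    by_contra hnot
    have hnot := not_lt.mp hnot
    have hne : (idx p').succ ≠ Fin.last (k + 1) := by
      intro h
      rw [h, O.last] at hnot
      exact hnot.not_gt ((e ^ s) (σ y)).2.2
    obtain ⟨j, hj⟩ := Fin.exists_castSucc_eq.mpr hne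
    rw [← hj] at hnot
    have hdp : (p' : ℝ) < cs j.castSucc := hj ▸ hp'c.2
    -- If a division point `c_j` separated the two orbits, some `z` of cell `i`, strictly right of
    -- its left end, would satisfy `f^s(γz) = c_j`. No earlier backward step from `c_j` meets the
    -- scaled window, so `g_γ(c_j) = z` belongs to `S`, which is impossible inside a cell.
    set z : ℝ := p + (cs j.castSucc - p') / γ with hz
    have hzp : (p : ℝ) < z := by
      have : 0 < (cs j.castSucc - p') / γ := div_pos (by linarith) hγ
      linarith
    have hzy : z ≤ y := by
      have : (cs j.castSucc - p') / γ ≤ y - p := by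
        rw [div_le_iff₀ hγ]
        linarith [htrans y hy]
      linarith
    have hzw : z ∈ window c ℓ := ⟨p.2.1.trans hzp.le, hzy.trans_lt y.2.2⟩
    have hzc : z ∈ cell cs i := ⟨by rw [← hp]; exact hzp.le, hzy.trans_lt hyc.2⟩
    have hzi : idx ⟨z, hzw⟩ = i := (hidx _ _).mp hzc
    have hsz : (e ^ s) (σ ⟨z, hzw⟩) = ⟨_, O.left_mem_window j⟩ := by
      apply Subtype.ext
      rw [htrans _ hzi]
      show p' + γ * (p + (cs j.castSucc - p') / γ - p) = cs j.castSucc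
      field_simp
      ring
    have hback : ∀ t : ℕ, t ≤ s →
        (e ^ (-(t : ℤ))) ⟨_, O.left_mem_window j⟩ = (e ^ (s - t)) (σ ⟨z, hzw⟩) := by
      intro t ht
      rw [← hsz, ← zpow_natCast, ← zpow_natCast, ← Equiv.Perm.mul_apply, ← zpow_add,
        Nat.cast_sub ht]
      congr 2
      ring
    have hg := S.gMap_eq (z := ⟨z, hzw⟩) (by simpa using hback s le_rfl) (fun t ht w => by
      rw [hback t ht.le]
      rcases Nat.eq_zero_or_pos t with rfl | ht0
      · exact havoid _ hzi ht hsm w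
      · exact (ih (s - t) (by omega) (by omega) _ hzi).2.1 (by omega) (by omega) w)
    obtain ⟨j', hj'⟩ := O.isLeast.1.2.2 (mem_range_self j)
    rw [show gMap ε c ℓ γ (cs j.castSucc) = z from hg] at hj'
    have : j' = i := cell_unique O.strictMono (left_mem_cell O.strictMono j') (by
      rw [show cs j'.castSucc = z from hj']
      exact hzc)
    subst this
    exact hzp.ne (hp.trans hj')

/-- The image of the letter of `y` is the itinerary of `γ y` up to its return, which happens at
`γ f(y)`. -/
theorem letter_image (O : IsOutput ε c ℓ γ cs φ vm v0 ψ) (S : IsSystem ε τ c ℓ γ γ' e σ)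
    {idx : window c ℓ → Fin (k + 1)} (hidx : ∀ (y : window c ℓ) i, (y : ℝ) ∈ cell cs i ↔ idx y = i)
    (y : window c ℓ) :
    0 < (φ (idx y)).length ∧ (e ^ (φ (idx y)).length) (σ y) = σ (e y) ∧
      ∀ (j : ℕ) (hj : j < (φ (idx y)).length), (φ (idx y))[j] = idx ((e ^ j) (σ y)) := by
  set i := idx y with hi
  set p : window c ℓ := ⟨_, O.left_mem_window i⟩ with hp
  obtain ⟨m, hm, hret, hmin⟩ := S.exists_first_return p
  obtain rfl : (φ i).length = m := (O.length i).unique (S.isLeast_return hm hret hmin)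
  have key := fun s hs => O.orbit_scaled_cell S hidx (p := p) rfl hmin s hs y hi.symm
  refine ⟨hm, ?_, fun j hj => ?_⟩
  · apply Subtype.ext
    rw [(key _ le_rfl).1, hret, S.coe_scale, S.coe_scale, S.coe_perm y,
      O.step_eq_of_mem_cell ((hidx y i).mpr hi.symm), S.coe_perm p]
    ring
  · rw [(key j hj.le).2.2 hj, eq_comm, ← hidx, ← S.iterate_step, S.coe_scale]
    exact O.letters i j hj

end IsOutput

/-! ### Fixed words from cutting positions. -/

section Words

variable {β : Type*}

/-- The block of length `m` of `v` that begins at position `s`. -/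
def block (v : ℤ → β) (s : ℤ) (m : ℕ) : List β := (List.range m).map fun i : ℕ => v (s + i)

@[simp]
theorem length_block (v : ℤ → β) (s : ℤ) (m : ℕ) : (block v s m).length = m := by
  simp [block]

theorem block_add (v : ℤ → β) (s : ℤ) (m n : ℕ) :
    block v s (m + n) = block v s m ++ block v (s + m) n := by
  simp [block, List.range_add, Function.comp_def, add_assoc]

theorem block_one (v : ℤ → β) (s : ℤ) : block v s 1 = [v s] := by simp [block]

theorem rightWord_eq_block (v : ℤ → β) (N : ℕ) : rightWord v N = block v 0 N := by
  simp [rightWord, block, ← List.map_eq_flatMap]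

theorem leftWord_eq_block (v : ℤ → β) (N : ℕ) : leftWord v N = block v (-N) N := by
  simp [leftWord, block, ← List.map_eq_flatMap, sub_eq_neg_add]

/-- `H` gives the positions at which the images of the letters of `v` begin in `v`. -/
structure IsCutting (φ : β → List β) (v : ℤ → β) (H : ℤ → ℤ) : Prop where
  zero : H 0 = 0
  pos : ∀ n, 0 < (φ (v n)).length
  succ : ∀ n, H (n + 1) = H n + (φ (v n)).length
  image : ∀ n, φ (v n) = block v (H n) (φ (v n)).length

namespace IsCutting

variable {φ : β → List β} {v : ℤ → β} {H : ℤ → ℤ}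

theorem strictMono (h : IsCutting φ v H) : StrictMono H :=
  strictMono_int_of_lt_succ fun n => by
    have := h.pos n
    rw [h.succ]
    omega

theorem exists_morph_block (h : IsCutting φ v H) (s : ℤ) (m : ℕ) :
    ∃ l : ℕ, morph φ (block v s m) = block v (H s) l ∧ H (s + m) = H s + l := by
  induction m with
  | zero => exact ⟨0, by simp [morph, block], by simp⟩
  | succ m ih =>
    obtain ⟨l, hl, hH⟩ := ih
    refine ⟨l + (φ (v (s + m))).length, ?_, ?_⟩
    · rw [block_add, block_one, block_add, ← hl, ← hH, ← h.image]
      simp [morph]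
    · rw [Nat.cast_succ, ← add_assoc, h.succ, hH]
      push_cast
      ring

theorem isFixedWord (h : IsCutting φ v H) : IsFixedWord φ v := by
  intro N
  constructor
  · obtain ⟨l, hl, -⟩ := h.exists_morph_block 0 N
    rw [h.zero] at hl
    rw [rightWord_eq_block, hl, length_block, rightWord_eq_block]
  · obtain ⟨l, hl, hH⟩ := h.exists_morph_block (-N) N
    rw [neg_add_cancel, h.zero] at hH
    rw [show H (-N) = -l by omega] at hl
    rw [leftWord_eq_block, hl, length_block, leftWord_eq_block]

theorem exists_iterate_right (h : IsCutting φ v H) (h₁ : 1 < (φ (v 0)).length) (n : ℕ) :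
    ∃ M : ℕ, n < M ∧ (morph φ)^[n] [v 0] = block v 0 M := by
  induction n with
  | zero => exact ⟨1, one_pos, by simp [block_one]⟩
  | succ n ih =>
    obtain ⟨M, hM, hn⟩ := ih
    obtain ⟨l, hl, hH⟩ := h.exists_morph_block 0 M
    rw [h.zero] at hl hH
    refine ⟨l, ?_, by rw [Function.iterate_succ_apply', hn, hl]⟩
    -- The first image contributes at least one extra letter, and strict monotonicity of `H`
    -- preserves this gain.
    have hgrow : ∀ M : ℕ, (M : ℤ) + 1 < H (M + 1) := by
      intro M
      induction M with
      | zero =>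
        have := h.succ 0
        rw [h.zero, zero_add] at this
        simp only [Nat.cast_zero, zero_add]
        omega
      | succ M ih =>
        have := h.strictMono (show (M : ℤ) + 1 < M + 1 + 1 by omega)
        push_cast
        omega
    obtain ⟨M, rfl⟩ : ∃ M', M = M' + 1 := ⟨M - 1, by omega⟩
    have := hgrow M
    push_cast at hH
    rw [zero_add] at hH
    omega

theorem exists_iterate_left (h : IsCutting φ v H) (h₁ : 1 < (φ (v (-1))).length) (n : ℕ) :
    ∃ M : ℕ, n < M ∧ (morph φ)^[n] [v (-1)] = block v (-M) M := by
  induction n with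
  | zero => exact ⟨1, one_pos, by simp [block_one]⟩
  | succ n ih =>
    obtain ⟨M, hM, hn⟩ := ih
    obtain ⟨l, hl, hH⟩ := h.exists_morph_block (-M) M
    rw [neg_add_cancel, h.zero] at hH
    rw [show H (-M) = -l by omega] at hl
    refine ⟨l, ?_, by rw [Function.iterate_succ_apply', hn, hl]⟩
    have hgrow : ∀ M : ℕ, H (-(M + 1)) < -(M + 1) := by
      intro M
      induction M with
      | zero =>
        have := h.succ (-1)
        rw [neg_add_cancel, h.zero] at this
        simp only [Nat.cast_zero, zero_add]
        omega
      | succ M ih =>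
        have := h.strictMono (show -((M : ℤ) + 1 + 1) < -(M + 1) by omega)
        push_cast
        omega
    obtain ⟨M, rfl⟩ : ∃ M', M = M' + 1 := ⟨M - 1, by omega⟩
    have := hgrow M
    push_cast at hH
    omega

theorem isLimitWord (h : IsCutting φ v H) (h₁ : 1 < (φ (v (-1))).length)
    (h₂ : 1 < (φ (v 0)).length) : IsLimitWord φ (v (-1)) (v 0) v := by
  refine ⟨rfl, rfl, h₁, h₂, h.isFixedWord, fun N => eventually_atTop.mpr ⟨N, fun n hn => ⟨?_, ?_⟩⟩⟩
  · obtain ⟨M, hM, hb⟩ := h.exists_iterate_left h₁ n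
    obtain ⟨d, rfl⟩ : ∃ d, M = d + N := ⟨M - N, by omega⟩
    rw [hb, leftWord_eq_block, block_add]
    rw [show -((d + N : ℕ) : ℤ) + d = -N by push_cast; ring]
    exact ⟨_, rfl⟩
  · obtain ⟨M, hM, hb⟩ := h.exists_iterate_right h₂ n
    obtain ⟨d, rfl⟩ : ∃ d, M = N + d := ⟨M - N, by omega⟩
    rw [hb, rightWord_eq_block, block_add]
    exact ⟨_, rfl⟩

end IsCutting

end Words

/-! ### Decoding the orbit of `0`. -/

/-- The stepping function translates each piece by the star image of the coded distance. -/
theorem step_of_mem_piece {ε c ℓ y : ℝ} (hℓ : ℓ < 1) {L : Letter} (hy : y ∈ piece ε c ℓ L) :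
    step ε c ℓ y = y + gap (1 + ε) ε L := by
  cases L with
  | A => rw [step, if_pos hy.2]; simp only [gap]; ring
  | B => rw [step, if_neg (not_lt.mpr hy.1), if_pos hy.2]; simp only [gap]; ring
  | C =>
    have h₁ : c - ε ≤ y := hy.1
    rw [step, if_neg (by linarith), if_neg (not_lt.mpr h₁)]; rfl

theorem piece_disjoint {ε c ℓ y : ℝ} (hℓ : ℓ < 1) {L L' : Letter} (h : y ∈ piece ε c ℓ L)
    (h' : y ∈ piece ε c ℓ L') : L = L' := by
  cases L <;> cases L' <;> first
    | rfl
    | (simp only [piece, mem_Ico] at h h'; linarith [h.1, h.2, h'.1, h'.2])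

namespace IsSystem

variable {ε τ c ℓ γ γ' : ℝ} {e : Equiv.Perm (window c ℓ)} {σ : window c ℓ → window c ℓ}

/-- If `f^n(0) = a_n + b_n ε`, the enumeration is `x_n = a_n + b_n η`: its gaps are positive, and it
is exhaustive because the orbit of `0` is all of `Ω ∩ ℤ[ε]`. -/
theorem isCutProjectWord (S : IsSystem ε τ c ℓ γ γ' e σ) {η : ℝ} (hη : 0 < η) {o : window c ℓ}
    (ho : (o : ℝ) = 0) {u : ℤ → Letter} (hu : ∀ n : ℤ, ((e ^ n) o : ℝ) ∈ piece ε c ℓ (u n)) :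
    IsCutProjectWord ε η c ℓ u := by
  have hℓ := S.length_lt_one
  choose a b hab _ _ using S.exists_zpow o
  have hsucc : ∀ n : ℤ, (a (n + 1) + b (n + 1) * η : ℝ) - (a n + b n * η) = gap (1 + η) η (u n) := by
    intro n
    have h : ((e ^ (n + 1)) o : ℝ) = (e ^ n) o + gap (1 + ε) ε (u n) := by
      rw [add_comm n 1, zpow_add, zpow_one, Equiv.Perm.mul_apply, S.coe_perm,
        step_of_mem_piece hℓ (hu n)]
    rw [hab, hab, ho, zero_add, zero_add] at h
    cases hL : u n with
    | A =>
      rw [hL, gap] at h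
      obtain ⟨h₁, h₂⟩ := intCoord_eq S.irrational (a := a (n + 1)) (b := b (n + 1))
        (a' := a n + 1) (b' := b n + 1) (by push_cast; linarith)
      rw [h₁, h₂, gap]; push_cast; ring
    | B =>
      rw [hL, gap] at h
      obtain ⟨h₁, h₂⟩ := intCoord_eq S.irrational (a := a (n + 1)) (b := b (n + 1))
        (a' := a n + 1) (b' := b n + 2) (by push_cast; linarith)
      rw [h₁, h₂, gap]; push_cast; ring
    | C =>
      rw [hL, gap] at h
      obtain ⟨h₁, h₂⟩ := intCoord_eq S.irrational (a := a (n + 1)) (b := b (n + 1))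
        (a' := a n) (b' := b n + 1) (by push_cast; linarith)
      rw [h₁, h₂, gap]; push_cast; ring
  -- Every orbit meets every nondegenerate subinterval, in particular each of the three pieces.
  have hoccurs : ∀ L, ∃ n, u n = L := by
    intro L
    have h₁ := S.neg_lt_length
    have h₂ := S.one_add_lt_length
    have h₃ := S.neg
    have h₄ := S.neg_one_lt
    obtain ⟨n, hn⟩ : ∃ n : ℤ, ((e ^ n) o : ℝ) ∈ piece ε c ℓ L := by
      cases L <;> exact S.exists_zpow_mem_Ico (by linarith) (by linarith) (by linarith) o
    exact ⟨n, piece_disjoint hℓ (hu n) hn⟩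
  refine ⟨fun n => a n + b n * η, strictMono_int_of_lt_succ fun n => ?_, ?_, ?_, ?_, hsucc⟩
  · have := hsucc n
    have hpos : 0 < gap (1 + η) η (u n) := by
      cases u n <;> simp only [gap] <;> linarith
    linarith
  · ext x
    constructor
    · rintro ⟨n, rfl⟩
      refine ⟨a n, b n, ?_, rfl⟩
      have := ((e ^ n) o).2
      rwa [hab, ho, zero_add] at this
    · rintro ⟨a', b', hmem, rfl⟩
      obtain ⟨n, hn⟩ := S.exists_zpow_eq (y := o) (x := ⟨_, hmem⟩) (a := a') (b := b') (by
        rw [ho, zero_add])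
      have h := congrArg Subtype.val hn
      rw [hab, ho, zero_add] at h
      obtain ⟨h₁, h₂⟩ := intCoord_eq S.irrational h
      exact ⟨n, by simp only [h₁, h₂]⟩
  · have h := hab 0
    rw [zpow_zero, Equiv.Perm.one_apply, ho, zero_add] at h
    obtain ⟨h₁, h₂⟩ := intCoord_eq S.irrational (a := 0) (b := 0) (by simpa using h)
    simp [← h₁, ← h₂]
  · simp only [hsucc]
    ext x
    constructor
    · rintro ⟨n, rfl⟩
      cases hL : u n <;> simp [gap, hL]
    · rintro (rfl | rfl | rfl)
      · obtain ⟨n, hn⟩ := hoccurs Letter.A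
        exact ⟨n, by simp only [hn, gap]⟩
      · obtain ⟨n, hn⟩ := hoccurs Letter.C
        exact ⟨n, by simp only [hn, gap]⟩
      · obtain ⟨n, hn⟩ := hoccurs Letter.B
        exact ⟨n, by simp only [hn, gap]⟩

theorem exists_word (S : IsSystem ε τ c ℓ γ γ' e σ) {η : ℝ} (hη : 0 < η) {k : ℕ}
    {cs : Fin (k + 2) → ℝ} {φ : Fin (k + 1) → List (Fin (k + 1))} {vm v0 : Fin (k + 1)}
    {ψ : Fin (k + 1) → Letter} (O : IsOutput ε c ℓ γ cs φ vm v0 ψ) :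
    ∃ v : ℤ → Fin (k + 1), IsLimitWord φ vm v0 v ∧
      IsCutProjectWord ε η c ℓ (fun n => ψ (v n)) := by
  obtain ⟨idx, hidx⟩ := O.exists_index
  set o : window c ℓ := ⟨0, S.left_nonpos, S.right_pos⟩ with ho
  have hσo : σ o = o := Subtype.ext (by rw [S.coe_scale]; simp [ho])
  -- `H n` is the time at which the orbit of the fixed point `0` of `σ` reaches `γ f^n(0)`.
  choose H hH _ using S.exists_zpow_scale o
  rw [hσo] at hH
  have hinj := S.zpow_injective o
  set v : ℤ → Fin (k + 1) := fun n => idx ((e ^ n) o) with hv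
  have hcut : IsCutting φ v H := by
    refine ⟨hinj ?_, fun n => (O.letter_image S hidx _).1, fun n => hinj ?_, fun n => ?_⟩
    · simpa [hσo] using hH 0
    · show (e ^ H (n + 1)) o = (e ^ (H n + ((φ (v n)).length : ℤ))) o
      rw [hH, add_comm (H n), zpow_add e _ (H n), Equiv.Perm.mul_apply, hH, zpow_natCast,
        (O.letter_image S hidx _).2.1, add_comm, zpow_add, zpow_one, Equiv.Perm.mul_apply]
    · apply List.ext_getElem (by simp)
      intro j h₁ h₂
      rw [(O.letter_image S hidx _).2.2 j h₁]
      simp only [block, List.getElem_map, List.getElem_range, hv]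
      rw [add_comm (H n), zpow_add, Equiv.Perm.mul_apply, hH, zpow_natCast]
  -- If `H n = n`, then `f^n(0)` is fixed by `γ`, so it is `0` and `n = 0`. At `n = ±1` this rules
  -- out images of length one next to the origin.
  have hfix : ∀ n, H n = n → n = 0 := by
    intro n hn
    have h := hH n
    rw [hn] at h
    have h₁ : (((e ^ n) o : window c ℓ) : ℝ) = γ * ((e ^ n) o : window c ℓ) := by
      rw [← S.coe_scale, ← h]
    have h₂ : (((e ^ n) o : window c ℓ) : ℝ) = 0 := by
      have : (1 - γ) * ((e ^ n) o : window c ℓ) = 0 := by linarith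
      rcases mul_eq_zero.mp this with h | h
      · linarith [S.scale_lt_one]
      · exact h
    exact hinj (a₁ := n) (a₂ := 0) (by simpa using Subtype.ext h₂)
  have hleft : 1 < (φ (v (-1))).length := by
    have h₁ := hcut.pos (-1)
    have h₂ := hcut.succ (-1)
    rw [neg_add_cancel, hcut.zero] at h₂
    by_contra hn
    have := hfix (-1) (by omega)
    omega
  have hright : 1 < (φ (v 0)).length := by
    have h₁ := hcut.pos 0
    have h₂ := hcut.succ 0
    rw [zero_add, hcut.zero] at h₂
    by_contra hn
    have := hfix 1 (by omega)
    omega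
  have hv0 : v 0 = v0 := (hidx _ _).mp (by simpa using O.mem_v0)
  have hvm : v (-1) = vm := (hidx _ _).mp (by
    have := O.mem_vm
    rwa [show (0 : ℝ) = o from rfl, S.stepInv_coe, show e.symm o = (e ^ (-1 : ℤ)) o by
      rw [zpow_neg_one]; rfl] at this)
  refine ⟨v, ?_, S.isCutProjectWord hη (o := o) rfl fun n => ?_⟩
  · have := hcut.isLimitWord hleft hright
    rwa [hv0, hvm] at this
  · exact O.mem_piece_of_mem_cell ((e ^ n) o).2 ((hidx _ _).mpr rfl)

end IsSystem

end CutProject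

theorem theorem6p3 (ε η c ℓ : ℝ)
    (hε : -1 < ε) (hε' : ε < 0) (hη : 0 < η) (hc : c ≤ 0) (hcℓ : 0 < c + ℓ)
    (hmax : max (-ε) (1 + ε) < ℓ) (hℓ : ℓ < 1)
    (hquad : CutProject.IsQuadratic ε) (hconj : 0 < CutProject.conj ε)
    (hcQ : c ∈ IntermediateField.adjoin ℚ ({ε} : Set ℝ))
    (hℓQ : ℓ ∈ IntermediateField.adjoin ℚ ({ε} : Set ℝ)) :
    -- the stepping function is a bijection of the window, and Step 1 has a solution
    Set.BijOn (CutProject.step ε c ℓ) (CutProject.window c ℓ) (CutProject.window c ℓ) ∧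
    (∃ γ : ℝ, CutProject.IsAdmissibleUnit ε γ) ∧
    ∀ γ : ℝ, CutProject.IsAdmissibleUnit ε γ →
      -- `ind(x)` is defined at every point of the window
      (∀ x ∈ CutProject.window c ℓ,
        ∃ i : ℕ, (CutProject.stepInv ε c ℓ)^[i] x ∈ CutProject.scaled γ c ℓ) ∧
      -- the remaining steps can be carried out; in particular the alphabet is finite
      (∃ (k : ℕ) (cs : Fin (k + 2) → ℝ) (φ : Fin (k + 1) → List (Fin (k + 1)))
        (vm v0 : Fin (k + 1)) (ψ : Fin (k + 1) → CutProject.Letter),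
        CutProject.IsOutput ε c ℓ γ cs φ vm v0 ψ) ∧
      -- their result generates the cut-and-project word
      ∀ (k : ℕ) (cs : Fin (k + 2) → ℝ) (φ : Fin (k + 1) → List (Fin (k + 1)))
        (vm v0 : Fin (k + 1)) (ψ : Fin (k + 1) → CutProject.Letter),
        CutProject.IsOutput ε c ℓ γ cs φ vm v0 ψ →
        ∃ v : ℤ → Fin (k + 1), CutProject.IsLimitWord φ vm v0 v ∧
          CutProject.IsCutProjectWord ε η c ℓ (fun n => ψ (v n)) := by
  obtain ⟨h₁, h₂⟩ := max_lt_iff.mp hmax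
  have hbij := CutProject.step_bijOn (c := c) h₁ h₂ hℓ
  refine ⟨hbij, CutProject.exists_isAdmissibleUnit hquad, fun γ hγ => ?_⟩
  -- The window contains `0`, so contraction towards `0` keeps it inside itself.
  have hscale : ∀ y : CutProject.window c ℓ, γ * (y : ℝ) ∈ CutProject.window c ℓ := by
    rintro ⟨y, hy₁, hy₂⟩
    have := hγ.pos
    have := hγ.lt_one
    constructor
    · show c ≤ γ * y
      nlinarith
    · show γ * y < c + ℓ
      nlinarith
  have S : CutProject.IsSystem ε (CutProject.conj ε) c ℓ γ (CutProject.conj γ)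
      (hbij.equiv (CutProject.step ε c ℓ)) (fun y => ⟨γ * y, hscale y⟩) :=
    { hγ.isScaling hquad with
      neg_one_lt := hε
      neg := hε'
      irrational := hquad.irrational
      conj_pos := hconj
      left_nonpos := hc
      right_pos := hcℓ
      neg_lt_length := h₁
      one_add_lt_length := h₂
      length_lt_one := hℓ
      scale_pos := hγ.pos
      scale_lt_one := hγ.lt_one
      one_lt_conj_scale := hγ.one_lt_conj
      coe_perm := fun y => rfl
      coe_scale := fun y => rfl }
  obtain ⟨uc, vc, huc⟩ := CutProject.exists_coord_of_mem_adjoin hquad hcQ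
  obtain ⟨ul, vl, hul⟩ := CutProject.exists_coord_of_mem_adjoin hquad hℓQ
  exact ⟨fun x hx => S.exists_stepInv_mem hx, S.exists_isOutput huc hul,
    fun k cs φ vm v0 ψ O => S.exists_word hη O⟩
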